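/- Justification terms are generated by $t ::= c_i \mid x_i \mid (t\cdot t)\mid (t+t)\mid\, !t$ and formulae by $F ::= p_i \mid \neg F\mid (F\to F)\mid t:F$ ($i\in\mathbb N$), with $A\vee B := \neg A\to B$ and $\bot := \neg(p_0\to p_0)$. Fix finitely many propositional schemes (built from metavariables with $\neg,\to$) which axiomatize classical propositional logic, i.e. whose instances together with modus ponens derive exactly the tautologies. The axioms of $\mathsf J$ are all instances of these schemes and of $t:(A\to B)\to(s:A\to t\cdot s:B)$ and $t:A\vee s:A\to t+s:A$. Consider further the schemes (jd) $t:\bot\to\bot$, (jt) $t:A\to A$, (j4) $t:A\to\,!t:t:A$; $\mathsf{JD}$ adds (jd), $\mathsf{JT}$ adds (jt), $\mathsf{J4}$ adds (j4), $\mathsf{JD4}$ adds (jd) and (j4), and $\mathsf{LP}$ adds (jt) and (j4). A constant specification $\mathsf{CS}$ for $\mathsf L$ is a set of pairs $c:A$ with $c$ a constant and $A$ an axiom of $\mathsf L$. It is axiomatically appropriate if for each axiom $A$ of $\mathsf L$ there is a constant $c$ with $c:A\in\mathsf{CS}$; it is schematic if for each constant $c$ the set $\{A\mid c:A\in\mathsf{CS}\}$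 is the set of all instances of some (possibly zero) of the axiom schemes of $\mathsf L$. The system $\mathsf L_{\mathsf{CS}}$ has the axioms of $\mathsf L$, modus ponens, and axiom necessitation: if $c:A\in \mathsf{CS}$, infer $c:A$ when $\mathsf L$ contains (j4), and infer $\underbrace{!\cdots!}_{n}c:\underbrace{!\cdots!}_{n-1}c:\cdots:\,!c:c:A$ for every $n\ge 0$ when $\mathsf L$ does not contain (j4). A model for $\mathsf L_{\mathsf{CS}}$ is a tuple $(W,R,\mathcal E,\nu)$ with $W\neq\varnothing$; $R\subseteq W\times W$ transitive if $\mathsf L$ contains (j4), reflexive if it contains (jt), serial if it contains (jd); $\nu$ assigning to each $p_i$ a subset of $W$; and $\mathcal E$ a set of triples (term, formula, world) such that: $(s,A,w)\in\mathcal E$ or $(t,A,w)\in\mathcal E$ implies $(s+t,A,w)\in\mathcal E$; $(s,A\to B,w),(t,A,w)\in\mathcal E$ implies $(s\cdot t,B,w)\in\mathcal E$; without (j4), $c:A\in\mathsf{CS}$ implies $(\underbrace{!\cdots!}_{n}c,\ \underbrace{!\cdots!}_{n-1}c:\cdots:\,!c:c:A,\ w)\in\mathcal E$ for all $w\in W$,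 $n\ge0$; with (j4), $c:A\in\mathsf{CS}$ implies $(c,A,w)\in\mathcal E$ for all $w\in W$, $(t,A,w)\in\mathcal E$ implies $(!t,t:A,w)\in\mathcal E$, and $(t,A,w)\in\mathcal E$ and $wRv$ imply $(t,A,v)\in\mathcal E$. Satisfaction is classical for $\neg,\to$; $p_i$ holds at $w$ iff $w\in\nu(p_i)$; and $t:B$ holds at $w$ iff $(t,B,w)\in\mathcal E$ and $B$ holds at all $v$ with $wRv$. A formula is satisfiable for $\mathsf L_{\mathsf{CS}}$ if it holds at some world of some model for $\mathsf L_{\mathsf{CS}}$. Call $\mathsf{CS}$ decidable if membership in it is decidable, and call $\mathsf L_{\mathsf{CS}}$ decidable if both the set of formulae derivable in $\mathsf L_{\mathsf{CS}}$ and the set of formulae satisfiable for $\mathsf L_{\mathsf{CS}}$ are decidable. **Corollary (Decidability).** 1. Let $\mathsf L\in\{\mathsf J,\mathsf{JT},\mathsf{J4},\mathsf{LP}\}$ and let $\mathsf{CS}$ be a decidable schematic constant specification for $\mathsf L$. Then $\mathsf L_{\mathsf{CS}}$ is decidable. 2. Let $\mathsf L\in\{\mathsf{JD},\mathsf{JD4}\}$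 and let $\mathsf{CS}$ be a decidable, schematic and axiomatically appropriate constant specification for $\mathsf L$. Then $\mathsf L_{\mathsf{CS}}$ is decidable. -/

import Mathlib

universe u

namespace JustLogic

/-! ### Terms and formulae -/

/-- Justification terms over constants `c₀, c₁, …` and variables `x₀, x₁, …`. -/
inductive Tm : Type
  | const (i : ℕ) : Tm
  | var (i : ℕ) : Tm
  | app (s t : Tm) : Tm
  | sum (s t : Tm) : Tm
  | bang (t : Tm) : Tm

/-- Formulae over atomic propositions `p₀, p₁, …`; `just t A` is `t : A`. -/
inductive Fm : Type
  | atom (i : ℕ) : Fm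
  | neg (A : Fm) : Fm
  | imp (A B : Fm) : Fm
  | just (t : Tm) (A : Fm) : Fm

namespace Fm

/-- Disjunction, `A ∨ B := ¬ A → B`. -/
def disj (A B : Fm) : Fm := imp (neg A) B

/-- Falsum, `⊥ := ¬ (p₀ → p₀)`. -/
def bot : Fm := neg (imp (atom 0) (atom 0))

end Fm

/-! ### Gödel numbering

Explicit bijections of terms and of formulae with `ℕ`; they give sense to computability of predicates
on formulae. -/

namespace Tm

/-- The Gödel number of a term. -/
def toNat : Tm → ℕ
  | const i => 5 * i
  | var i => 5 * i + 1
  | app s t => 5 * Nat.pair s.toNat t.toNat + 2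
  | sum s t => 5 * Nat.pair s.toNat t.toNat + 3
  | bang t => 5 * t.toNat + 4

theorem exists_toNat (n : ℕ) : ∃ t : Tm, t.toNat = n := by
  induction n using Nat.strong_induction_on with
  | _ n ih =>
    have h1 := Nat.unpair_left_le (n / 5)
    have h2 := Nat.unpair_right_le (n / 5)
    have hp := Nat.pair_unpair (n / 5)
    have hd := Nat.div_add_mod n 5
    have hlt : n % 5 < 5 := Nat.mod_lt _ (by norm_num)
    rcases (by omega : n % 5 = 0 ∨ n % 5 = 1 ∨ n % 5 = 2 ∨ n % 5 = 3 ∨ n % 5 = 4) with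
      h | h | h | h | h
    · exact ⟨const (n / 5), by simp only [toNat]; omega⟩
    · exact ⟨var (n / 5), by simp only [toNat]; omega⟩
    · obtain ⟨s, hs⟩ := ih (n / 5).unpair.1 (by omega)
      obtain ⟨t, ht⟩ := ih (n / 5).unpair.2 (by omega)
      exact ⟨app s t, by simp only [toNat, hs, ht, hp]; omega⟩
    · obtain ⟨s, hs⟩ := ih (n / 5).unpair.1 (by omega)
      obtain ⟨t, ht⟩ := ih (n / 5).unpair.2 (by omega)
      exact ⟨sum s t, by simp only [toNat, hs, ht, hp]; omega⟩
    · obtain ⟨t, ht⟩ := ih (n / 5) (by omega)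
      exact ⟨bang t, by simp only [toNat, ht]; omega⟩

theorem toNat_injective : Function.Injective toNat := by
  intro s
  induction s with
  | const i => intro t h; cases t <;> simp only [toNat] at h <;> first | omega | (congr 1; omega)
  | var i => intro t h; cases t <;> simp only [toNat] at h <;> first | omega | (congr 1; omega)
  | app s₁ s₂ ih₁ ih₂ =>
    intro t h
    cases t <;> simp only [toNat] at h <;> try omega
    rename_i a b
    obtain ⟨h1, h2⟩ := Nat.pair_eq_pair.1
      (by omega : Nat.pair s₁.toNat s₂.toNat = Nat.pair a.toNat b.toNat)
    rw [ih₁ h1, ih₂ h2]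
  | sum s₁ s₂ ih₁ ih₂ =>
    intro t h
    cases t <;> simp only [toNat] at h <;> try omega
    rename_i a b
    obtain ⟨h1, h2⟩ := Nat.pair_eq_pair.1
      (by omega : Nat.pair s₁.toNat s₂.toNat = Nat.pair a.toNat b.toNat)
    rw [ih₁ h1, ih₂ h2]
  | bang s ih =>
    intro t h
    cases t <;> simp only [toNat] at h <;> try omega
    rename_i a
    rw [ih (by omega : s.toNat = a.toNat)]

/-- The Gödel numbering of terms as a bijection. -/
noncomputable def equivNat : Tm ≃ ℕ :=
  Equiv.ofBijective toNat ⟨toNat_injective, exists_toNat⟩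

noncomputable instance : Denumerable Tm := Denumerable.mk' equivNat

end Tm

namespace Fm

/-- The Gödel number of a formula. -/
def toNat : Fm → ℕ
  | atom i => 4 * i
  | neg A => 4 * A.toNat + 1
  | imp A B => 4 * Nat.pair A.toNat B.toNat + 2
  | just t A => 4 * Nat.pair t.toNat A.toNat + 3

theorem exists_toNat (n : ℕ) : ∃ A : Fm, A.toNat = n := by
  induction n using Nat.strong_induction_on with
  | _ n ih =>
    have h1 := Nat.unpair_left_le (n / 4)
    have h2 := Nat.unpair_right_le (n / 4)
    have hp := Nat.pair_unpair (n / 4)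
    have hd := Nat.div_add_mod n 4
    have hlt : n % 4 < 4 := Nat.mod_lt _ (by norm_num)
    rcases (by omega : n % 4 = 0 ∨ n % 4 = 1 ∨ n % 4 = 2 ∨ n % 4 = 3) with h | h | h | h
    · exact ⟨atom (n / 4), by simp only [toNat]; omega⟩
    · obtain ⟨A, hA⟩ := ih (n / 4) (by omega)
      exact ⟨neg A, by simp only [toNat, hA]; omega⟩
    · obtain ⟨A, hA⟩ := ih (n / 4).unpair.1 (by omega)
      obtain ⟨B, hB⟩ := ih (n / 4).unpair.2 (by omega)
      exact ⟨imp A B, by simp only [toNat, hA, hB, hp]; omega⟩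
    · obtain ⟨t, ht⟩ := Tm.exists_toNat (n / 4).unpair.1
      obtain ⟨A, hA⟩ := ih (n / 4).unpair.2 (by omega)
      exact ⟨just t A, by simp only [toNat, ht, hA, hp]; omega⟩

theorem toNat_injective : Function.Injective toNat := by
  intro A
  induction A with
  | atom i => intro B h; cases B <;> simp only [toNat] at h <;> first | omega | (congr 1; omega)
  | neg A ih =>
    intro B h
    cases B <;> simp only [toNat] at h <;> try omega
    rename_i B
    rw [ih (by omega : A.toNat = B.toNat)]
  | imp A₁ A₂ ih₁ ih₂ =>
    intro B h
    cases B <;> simp only [toNat] at h <;> try omega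
    rename_i a b
    obtain ⟨h1, h2⟩ := Nat.pair_eq_pair.1
      (by omega : Nat.pair A₁.toNat A₂.toNat = Nat.pair a.toNat b.toNat)
    rw [ih₁ h1, ih₂ h2]
  | just t A ih =>
    intro B h
    cases B <;> simp only [toNat] at h <;> try omega
    rename_i a b
    obtain ⟨h1, h2⟩ := Nat.pair_eq_pair.1
      (by omega : Nat.pair t.toNat A.toNat = Nat.pair a.toNat b.toNat)
    rw [Tm.toNat_injective h1, ih h2]

/-- The Gödel numbering of formulae as a bijection. -/
noncomputable def equivNat : Fm ≃ ℕ :=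
  Equiv.ofBijective toNat ⟨toNat_injective, exists_toNat⟩

noncomputable instance : Denumerable Fm := Denumerable.mk' equivNat

end Fm

/-! ### Axiom schemes -/

/-- Propositional schemes, built from metavariables by `¬` and `→`. -/
inductive PropScheme : Type
  | mvar (i : ℕ) : PropScheme
  | neg (S : PropScheme) : PropScheme
  | imp (S T : PropScheme) : PropScheme

namespace PropScheme

/-- Truth of a propositional scheme under a truth assignment. -/
def Eval (v : ℕ → Prop) : PropScheme → Prop
  | mvar i => v i
  | neg S => ¬ S.Eval v
  | imp S T => S.Eval v → T.Eval v

/-- Uniform substitution of propositional schemes for the metavariables. -/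
def subst (σ : ℕ → PropScheme) : PropScheme → PropScheme
  | mvar i => σ i
  | neg S => neg (S.subst σ)
  | imp S T => imp (S.subst σ) (T.subst σ)

/-- The instance of a propositional scheme under an assignment of formulae to metavariables. -/
def inst (σ : ℕ → Fm) : PropScheme → Fm
  | mvar i => σ i
  | neg S => Fm.neg (S.inst σ)
  | imp S T => Fm.imp (S.inst σ) (T.inst σ)

/-- Derivability from the substitution instances of the schemes in `P` by modus ponens. -/
inductive Derivable (P : Finset PropScheme) : PropScheme → Prop
  | ax {S : PropScheme} (hS : S ∈ P) (σ : ℕ → PropScheme) : Derivable P (S.subst σ)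
  | mp {S T : PropScheme} : Derivable P S → Derivable P (imp S T) → Derivable P T

end PropScheme

/-- The finitely many schemes in `P` axiomatize classical propositional logic: with modus ponens as
the only rule they derive exactly the tautologies. -/
def AxiomatizesCPL (P : Finset PropScheme) : Prop :=
  ∀ S : PropScheme, PropScheme.Derivable P S ↔ ∀ v : ℕ → Prop, S.Eval v

/-- The six justification logics. -/
inductive JLogic : Type
  | J
  | JD
  | JT
  | J4
  | JD4
  | LP

namespace JLogic

/-- `L` includes the axiom scheme jd. -/
def HasD (L : JLogic) : Prop := L = JD ∨ L = JD4

/-- `L` includes the axiom scheme jt. -/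
def HasT (L : JLogic) : Prop := L = JT ∨ L = LP

/-- `L` includes the axiom scheme j4. -/
def Has4 (L : JLogic) : Prop := L = J4 ∨ L = JD4 ∨ L = LP

end JLogic

/-- Axiom schemes of justification logics: propositional ones, and those for application, sum,
seriality, factivity and positive introspection. -/
inductive AxScheme : Type
  | ofProp (S : PropScheme)
  | app
  | sum
  | jd
  | jt
  | j4

/-- `S.Instance A`: the formula `A` is an instance of the scheme `S`. -/
def AxScheme.Instance : AxScheme → Fm → Prop
  | ofProp S, F => ∃ σ : ℕ → Fm, F = S.inst σ
  | app, F => ∃ (s t : Tm) (A B : Fm),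
      F = .imp (.just t (.imp A B)) (.imp (.just s A) (.just (.app t s) B))
  | sum, F => ∃ (s t : Tm) (A : Fm),
      F = .imp (Fm.disj (.just t A) (.just s A)) (.just (.sum t s) A)
  | jd, F => ∃ t : Tm, F = .imp (.just t Fm.bot) Fm.bot
  | jt, F => ∃ (t : Tm) (A : Fm), F = .imp (.just t A) A
  | j4, F => ∃ (t : Tm) (A : Fm), F = .imp (.just t A) (.just (.bang t) (.just t A))

/-- The axiom schemes of the logic `L`, with `P` as the propositional schemes. -/
def AxScheme.Of (P : Finset PropScheme) (L : JLogic) : AxScheme → Prop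
  | ofProp S => S ∈ P
  | app => True
  | sum => True
  | jd => L.HasD
  | jt => L.HasT
  | j4 => L.Has4

/-- The axioms of `L` are all instances of its axiom schemes. -/
def IsAxiom (P : Finset PropScheme) (L : JLogic) (A : Fm) : Prop :=
  ∃ S : AxScheme, S.Of P L ∧ S.Instance A

/-! ### Constant specifications -/

/-- Sets of pairs `(i, A)`, read as statements `cᵢ : A`. -/
abbrev CSet : Type := Set (ℕ × Fm)

/-- `CS` is a constant specification for `L`. -/
def IsConstSpec (P : Finset PropScheme) (L : JLogic) (CS : CSet) : Prop :=
  ∀ (i : ℕ) (A : Fm), (i, A) ∈ CS → IsAxiom P L A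

/-- Every axiom of `L` is justified by some constant. -/
def AxiomaticallyAppropriate (P : Finset PropScheme) (L : JLogic) (CS : CSet) : Prop :=
  ∀ A : Fm, IsAxiom P L A → ∃ i : ℕ, (i, A) ∈ CS

/-- For every constant, the formulae that it justifies are exactly the instances of certain (possibly
zero) axiom schemes of `L`. -/
def Schematic (P : Finset PropScheme) (L : JLogic) (CS : CSet) : Prop :=
  ∀ i : ℕ, ∃ 𝒮 : Set AxScheme, (∀ S ∈ 𝒮, S.Of P L) ∧
    ∀ A : Fm, (i, A) ∈ CS ↔ ∃ S ∈ 𝒮, S.Instance A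

/-- Membership in `CS` is decidable. -/
def DecidableCS (CS : CSet) : Prop :=
  ComputablePred fun q : ℕ × Fm => q ∈ CS

/-! ### Deductive systems -/

/-- The term `!⋯!cᵢ` with `n` exclamation marks. -/
def bangs (i : ℕ) : ℕ → Tm
  | 0 => Tm.const i
  | n + 1 => Tm.bang (bangs i n)

/-- The formula `!⋯!cᵢ : ⋯ : !cᵢ : cᵢ : A` with `n` terms in front of `A`, the outermost of which
has `n - 1` exclamation marks (just `A` for `n = 0`). -/
def tower (i : ℕ) (A : Fm) : ℕ → Fm
  | 0 => A
  | n + 1 => Fm.just (bangs i n) (tower i A n)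

/-- Derivability in the Hilbert system `L_CS`. -/
inductive Derivable (P : Finset PropScheme) (L : JLogic) (CS : CSet) : Fm → Prop
  | ax {A : Fm} : IsAxiom P L A → Derivable P L CS A
  | mp {A B : Fm} : Derivable P L CS A → Derivable P L CS (Fm.imp A B) → Derivable P L CS B
  | anBang {i : ℕ} {A : Fm} (n : ℕ) : ¬ L.Has4 → (i, A) ∈ CS →
      Derivable P L CS (Fm.just (bangs i n) (tower i A n))
  | an {i : ℕ} {A : Fm} : L.Has4 → (i, A) ∈ CS → Derivable P L CS (Fm.just (Tm.const i) A)

/-! ### Semantics -/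

/-- Admissible evidence relations for `L_CS` over the frame `(W, R)`. -/
structure IsEvidence (L : JLogic) (CS : CSet) {W : Type u} (R : W → W → Prop)
    (E : Tm → Fm → W → Prop) : Prop where
  sum : ∀ s t A w, E s A w ∨ E t A w → E (.sum s t) A w
  app : ∀ s t A B w, E s (.imp A B) w → E t A w → E (.app s t) B w
  anBang : ¬ L.Has4 → ∀ i A w, (i, A) ∈ CS → ∀ n, E (bangs i n) (tower i A n) w
  an : L.Has4 → ∀ i A w, (i, A) ∈ CS → E (.const i) A w
  bang : L.Has4 → ∀ t A w, E t A w → E (.bang t) (.just t A) w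
  mono : L.Has4 → ∀ t A w v, E t A w → R w v → E t A v

/-- Fitting models for `L_CS`. -/
structure Model (L : JLogic) (CS : CSet) : Type (u + 1) where
  W : Type u
  nonempty : Nonempty W
  R : W → W → Prop
  trans : L.Has4 → ∀ w v x, R w v → R v x → R w x
  refl : L.HasT → ∀ w, R w w
  serial : L.HasD → ∀ w, ∃ v, R w v
  E : Tm → Fm → W → Prop
  evidence : IsEvidence L CS R E
  ν : ℕ → Set W

/-- Satisfaction of a formula at a world of a model. -/
def Model.Sat {L : JLogic} {CS : CSet} (M : Model.{u} L CS) : Fm → M.W → Prop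
  | .atom i, w => w ∈ M.ν i
  | .neg A, w => ¬ M.Sat A w
  | .imp A B, w => M.Sat A w → M.Sat B w
  | .just t A, w => (∀ v, M.R w v → M.Sat A v) ∧ M.E t A w

/-- `A` holds at some world of some model for `L_CS`. -/
def Satisfiable (L : JLogic) (CS : CSet) (A : Fm) : Prop :=
  ∃ (M : Model.{u} L CS) (w : M.W), M.Sat A w

/-- The logic `L_CS` is decidable: derivability in `L_CS` is a decidable property of formulae, and so
is satisfiability in models for `L_CS`. -/
def DecidableLogic (P : Finset PropScheme) (L : JLogic) (CS : CSet) : Prop :=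
  ComputablePred (fun A : Fm => Derivable P L CS A) ∧
    ComputablePred (fun A : Fm => Satisfiable.{u} L CS A)

end JustLogic

namespace JustLogic

/-! ### Closure properties of computable predicates -/

section Computability

open Encodable Denumerable

variable {α β : Type*} [Primcodable α]

/-! Derivability reduces to satisfiability: by soundness and a canonical model, `A` is derivable iff
`¬A` is unsatisfiable (`derivable_iff_not_satisfiable_neg`). Axiomatic appropriateness serves only
to make the canonical model serial when (jd) is present.

Satisfiability has finite certificates (`satisfiable_iff_hasCertificate`). Let `N` exceed the code
of `A`, and describe a world by the set of formulae with codes below `N` that hold there. If `t : B`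
follows by the evidence rules from assertions true at a world, then `t : B` is itself true there. So
the set contains every `t : B` below `N` in the least evidence relation generated by its own
assertions. Conversely, a finite collection of sets with this property, together with the Boolean,
reflexivity and seriality conditions, is a model once each set is given its least evidence relation.

It remains to decide the least evidence relation. Evidence for a fixed term has derivations of
bounded size, but the formulae eliminated by application are unbounded, since a constant may justify
infinitely many formulae. Schematic specifications remedy this: membership of a formula depends on
only boundedly many of its constructors (`Schematic.exists_collapsible`). A derivation therefore
survives any map that fixes small codes and commutes with the constructors at a bounded list of
terms and formulae (`LeastEvidence.exists_respects`). Cutting off everything outside that list gives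
such a map, with range below a computable bound (`leastEvidence_iff_bounded`).

Below that bound evidence is found by finite search for a set each of whose members is justified by
others (`leastEvidence_iff_justified`). All quantifiers in a certificate are then bounded, so its
existence is decidable. -/

theorem ComputablePred.and' {p q : α → Prop} (hp : ComputablePred p) (hq : ComputablePred q) :
    ComputablePred fun a => p a ∧ q a := by
  obtain ⟨_, hp⟩ := hp
  obtain ⟨_, hq⟩ := hq
  exact Computable.computablePred
    ((Primrec.and.to_comp.comp hp hq).of_eq fun a => (Bool.decide_and _ _).symm)

theorem ComputablePred.or' {p q : α → Prop} (hp : ComputablePred p) (hq : ComputablePred q) :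
    ComputablePred fun a => p a ∨ q a :=
  (ComputablePred.and' hp.not hq.not).not.of_eq fun a => by tauto

theorem ComputablePred.imp' {p q : α → Prop} (hp : ComputablePred p) (hq : ComputablePred q) :
    ComputablePred fun a => p a → q a :=
  (ComputablePred.or' hp.not hq).of_eq fun a => by tauto

theorem ComputablePred.iff' {p q : α → Prop} (hp : ComputablePred p) (hq : ComputablePred q) :
    ComputablePred fun a => p a ↔ q a :=
  (ComputablePred.and' (ComputablePred.imp' hp hq) (ComputablePred.imp' hq hp)).of_eq
    fun a => by tauto

theorem ComputablePred.comp' [Primcodable β] {p : β → Prop} {f : α → β} (hp : ComputablePred p)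
    (hf : Computable f) : ComputablePred fun a => p (f a) := by
  obtain ⟨_, hp⟩ := hp
  exact Computable.computablePred (hp.comp hf)

/-- A constant function decides `p`, with its value chosen classically. This handles side conditions
on the logic such as `L.Has4`. -/
theorem ComputablePred.const' (p : Prop) : ComputablePred fun _ : α => p := by
  classical
  exact Computable.computablePred (Computable.const (decide p))

theorem ComputablePred.eq' [Primcodable β] {f g : α → β} (hf : Computable f)
    (hg : Computable g) : ComputablePred fun a => f a = g a :=
  ComputablePred.comp' (p := fun q : β × β => q.1 = q.2) (f := fun a => (f a, g a))
    (PrimrecPred.computablePred Primrec.eq) (hf.pair hg)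

theorem ComputablePred.lt' {f g : α → ℕ} (hf : Computable f)
    (hg : Computable g) : ComputablePred fun a => f a < g a :=
  ComputablePred.comp' (p := fun q : ℕ × ℕ => q.1 < q.2) (f := fun a => (f a, g a))
    (PrimrecPred.computablePred Primrec.nat_lt) (hf.pair hg)

theorem ComputablePred.exists_nat_lt {f : α → ℕ} (hf : Computable f) {p : α → ℕ → Prop}
    (hp : ComputablePred fun q : α × ℕ => p q.1 q.2) :
    ComputablePred fun a => ∃ n, n < f a ∧ p a n := by
  classical
  have hd : Computable fun q : α × ℕ => decide (p q.1 q.2) := hp.decide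
  have hs : Computable₂ fun (a : α) (q : ℕ × Bool) => q.2 || decide (p a q.1) :=
    Primrec.or.to_comp.comp (Computable.snd.comp Computable.snd)
      (hd.comp (Computable.fst.pair (Computable.fst.comp Computable.snd)))
  refine Computable.computablePred
    ((Computable.nat_rec hf (Computable.const false) hs).of_eq fun a => ?_)
  generalize f a = m
  induction m with
  | zero => simp
  | succ m ih =>
    simp only [ih, ← Bool.decide_or, decide_eq_decide]
    constructor
    · rintro (⟨n, h1, h2⟩ | h)
      exacts [⟨n, by omega, h2⟩, ⟨m, by omega, h⟩]
    · rintro ⟨n, h1, h2⟩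
      rcases Nat.lt_succ_iff_lt_or_eq.1 h1 with h | rfl
      exacts [Or.inl ⟨n, h, h2⟩, Or.inr h2]

/-- Decoding turns a quantifier over terms or formulae with bounded code into one over natural
numbers. All later decision procedures are assembled from such bounded quantifiers. -/
theorem ComputablePred.exists_lt [Denumerable β] {f : α → ℕ} (hf : Computable f)
    {p : α → β → Prop} (hp : ComputablePred fun q : α × β => p q.1 q.2) :
    ComputablePred fun a => ∃ b, encode b < f a ∧ p a b := by
  have h : ComputablePred fun q : α × ℕ => p q.1 (ofNat β q.2) :=
    ComputablePred.comp' (f := fun q : α × ℕ => (q.1, ofNat β q.2)) hp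
      (Computable.fst.pair ((Computable.ofNat β).comp Computable.snd))
  refine (ComputablePred.exists_nat_lt hf (p := fun a n => p a (ofNat β n)) h).of_eq fun a => ?_
  constructor
  · rintro ⟨n, h1, h2⟩
    exact ⟨ofNat β n, by rwa [encode_ofNat], h2⟩
  · rintro ⟨b, h1, h2⟩
    exact ⟨encode b, h1, by rwa [ofNat_encode]⟩

theorem ComputablePred.forall_lt [Denumerable β] {f : α → ℕ} (hf : Computable f)
    {p : α → β → Prop} (hp : ComputablePred fun q : α × β => p q.1 q.2) :
    ComputablePred fun a => ∀ b, encode b < f a → p a b :=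
  (ComputablePred.exists_lt hf (p := fun a b => ¬ p a b) hp.not).not.of_eq fun a => by
    push Not
    rfl

theorem computable_two_pow {f : α → ℕ} (hf : Computable f) : Computable fun a => 2 ^ f a :=
  (Primrec₂.unpaired'.1 Nat.Primrec.pow).to_comp.comp (Computable.const 2) hf

theorem computable_add {f g : α → ℕ} (hf : Computable f) (hg : Computable g) :
    Computable fun a => f a + g a :=
  Primrec.nat_add.to_comp.comp hf hg

theorem computable_mul {f g : α → ℕ} (hf : Computable f) (hg : Computable g) :
    Computable fun a => f a * g a :=
  Primrec.nat_mul.to_comp.comp hf hg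

theorem computable_encode [Primcodable β] {f : α → β} (hf : Computable f) :
    Computable fun a => encode (f a) :=
  Computable.encode.comp hf

theorem ComputablePred.testBit {f g : α → ℕ} (hf : Computable f) (hg : Computable g) :
    ComputablePred fun a => (f a).testBit (g a) = true := by
  refine (ComputablePred.eq' (f := fun a => f a / 2 ^ g a % 2) (g := fun _ => 1)
    (Primrec.nat_mod.to_comp.comp
      (Primrec.nat_div.to_comp.comp hf (computable_two_pow hg)) (Computable.const 2))
    (Computable.const 1)).of_eq fun a => ?_
  rw [Nat.testBit_eq_decide_div_mod_eq, decide_eq_true_iff]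

end Computability

/-! ### Computability of the term and formula constructors -/

section Constructors

open Encodable

theorem Tm.encode_eq (t : Tm) : encode t = t.toNat := rfl

variable {α : Type*} [Primcodable α]

/-- Encoding is the Gödel number by definition, so for each constructor it is enough that the
arithmetic expression for its code is computable. -/
theorem computable_const {f : α → ℕ} (hf : Computable f) : Computable fun a => Tm.const (f a) :=
  Computable.encode_iff.1 (computable_mul (Computable.const 5) hf)

theorem computable_app {f g : α → Tm} (hf : Computable f) (hg : Computable g) :
    Computable fun a => Tm.app (f a) (g a) :=
  Computable.encode_iff.1 (computable_add (computable_mul (Computable.const 5)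
    (Primrec₂.natPair.to_comp.comp (computable_encode hf) (computable_encode hg)))
    (Computable.const 2))

theorem computable_sum {f g : α → Tm} (hf : Computable f) (hg : Computable g) :
    Computable fun a => Tm.sum (f a) (g a) :=
  Computable.encode_iff.1 (computable_add (computable_mul (Computable.const 5)
    (Primrec₂.natPair.to_comp.comp (computable_encode hf) (computable_encode hg)))
    (Computable.const 3))

theorem computable_bang {f : α → Tm} (hf : Computable f) : Computable fun a => Tm.bang (f a) :=
  Computable.encode_iff.1 (computable_add (computable_mul (Computable.const 5)
    (computable_encode hf)) (Computable.const 4))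

theorem computable_neg {f : α → Fm} (hf : Computable f) : Computable fun a => Fm.neg (f a) :=
  Computable.encode_iff.1 (computable_add (computable_mul (Computable.const 4)
    (computable_encode hf)) (Computable.const 1))

theorem computable_imp {f g : α → Fm} (hf : Computable f) (hg : Computable g) :
    Computable fun a => Fm.imp (f a) (g a) :=
  Computable.encode_iff.1 (computable_add (computable_mul (Computable.const 4)
    (Primrec₂.natPair.to_comp.comp (computable_encode hf) (computable_encode hg)))
    (Computable.const 2))

theorem computable_just {f : α → Tm} {g : α → Fm} (hf : Computable f) (hg : Computable g) :
    Computable fun a => Fm.just (f a) (g a) :=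
  Computable.encode_iff.1 (computable_add (computable_mul (Computable.const 4)
    (Primrec₂.natPair.to_comp.comp (computable_encode hf) (computable_encode hg)))
    (Computable.const 3))

end Constructors

/-! ### Least evidence relations -/

/-- The evidence that comes from the constant specification, restricted to formulae in `Q`. -/
inductive CSEvidence (CS : CSet) (Q : Fm → Prop) : Tm → Fm → Prop
  | const {i : ℕ} {A : Fm} : (i, A) ∈ CS → Q A → CSEvidence CS Q (.const i) A
  | bang {t : Tm} {A : Fm} : CSEvidence CS Q t A → Q (.just t A) →
      CSEvidence CS Q (.bang t) (.just t A)

/-- The least evidence relation that contains `X`, generated by derivations in which all formulae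
are in `Q`. -/
inductive LeastEvidence (L : JLogic) (CS : CSet) (Q : Fm → Prop) (X : Tm → Fm → Prop) :
    Tm → Fm → Prop
  | base {t : Tm} {A : Fm} : X t A → Q A → LeastEvidence L CS Q X t A
  | cs {t : Tm} {A : Fm} : CSEvidence CS Q t A → LeastEvidence L CS Q X t A
  | suml {s t : Tm} {A : Fm} : LeastEvidence L CS Q X s A → LeastEvidence L CS Q X (.sum s t) A
  | sumr {s t : Tm} {A : Fm} : LeastEvidence L CS Q X t A → LeastEvidence L CS Q X (.sum s t) A
  | app {s t : Tm} {A B : Fm} : LeastEvidence L CS Q X s (.imp A B) → LeastEvidence L CS Q X t A →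
      Q B → LeastEvidence L CS Q X (.app s t) B
  | bang {t : Tm} {A : Fm} : L.Has4 → LeastEvidence L CS Q X t A → Q (.just t A) →
      LeastEvidence L CS Q X (.bang t) (.just t A)

theorem CSEvidence.mono {CS : CSet} {Q Q' : Fm → Prop} (h : ∀ A, Q A → Q' A) {t : Tm} {A : Fm}
    (hA : CSEvidence CS Q t A) : CSEvidence CS Q' t A := by
  induction hA with
  | const h1 h2 => exact .const h1 (h _ h2)
  | bang _ h2 ih => exact .bang ih (h _ h2)

theorem LeastEvidence.mono {L : JLogic} {CS : CSet} {Q Q' : Fm → Prop} {X X' : Tm → Fm → Prop}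
    (h : ∀ A, Q A → Q' A) (hX : ∀ t A, X t A → X' t A) {t : Tm} {A : Fm}
    (hA : LeastEvidence L CS Q X t A) : LeastEvidence L CS Q' X' t A := by
  induction hA with
  | base h1 h2 => exact .base (hX _ _ h1) (h _ h2)
  | cs h1 => exact .cs (h1.mono h)
  | suml _ ih => exact .suml ih
  | sumr _ ih => exact .sumr ih
  | app _ _ h2 ih1 ih2 => exact .app ih1 ih2 (h _ h2)
  | bang h4 _ h2 ih => exact .bang h4 ih (h _ h2)

/-- Evidence from the specification consists of the towers of axiom necessitation without (j4).
Keeping it apart from the other rules lets one relation serve logics with and without (j4). -/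
theorem CSEvidence.exists_bangs {CS : CSet} {Q : Fm → Prop} {t : Tm} {A : Fm}
    (h : CSEvidence CS Q t A) :
    ∃ i n B, (i, B) ∈ CS ∧ t = bangs i n ∧ A = tower i B n := by
  induction h with
  | const h _ => exact ⟨_, 0, _, h, rfl, rfl⟩
  | bang _ _ ih =>
    obtain ⟨i, n, B, h, rfl, rfl⟩ := ih
    exact ⟨i, n + 1, B, h, rfl, rfl⟩

theorem CSEvidence.of_mem {CS : CSet} {i : ℕ} {A : Fm} (h : (i, A) ∈ CS) (n : ℕ) :
    CSEvidence CS (fun _ => True) (bangs i n) (tower i A n) := by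
  induction n with
  | zero => exact .const h trivial
  | succ n ih => exact .bang ih trivial

theorem CSEvidence.prop {CS : CSet} {Q : Fm → Prop} {t : Tm} {A : Fm}
    (h : CSEvidence CS Q t A) : Q A := by
  cases h <;> assumption

theorem LeastEvidence.prop {L : JLogic} {CS : CSet} {Q : Fm → Prop} {X : Tm → Fm → Prop} {t : Tm}
    {A : Fm} (h : LeastEvidence L CS Q X t A) : Q A := by
  induction h with
  | base _ h => exact h
  | cs h => exact h.prop
  | suml _ ih => exact ih
  | sumr _ ih => exact ih
  | app _ _ h => exact h
  | bang _ _ h => exact h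

/-! ### Codes of subterms and subformulae -/

theorem Tm.toNat_app_lt (s t : Tm) :
    s.toNat < (app s t).toNat ∧ t.toNat < (app s t).toNat ∧
      s.toNat + t.toNat < (app s t).toNat := by
  have h1 := Nat.left_le_pair s.toNat t.toNat
  have h2 := Nat.right_le_pair s.toNat t.toNat
  have h3 := Nat.add_le_pair s.toNat t.toNat
  simp only [toNat]
  omega

theorem Tm.toNat_sum_lt (s t : Tm) :
    s.toNat < (sum s t).toNat ∧ t.toNat < (sum s t).toNat := by
  have h1 := Nat.left_le_pair s.toNat t.toNat
  have h2 := Nat.right_le_pair s.toNat t.toNat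
  simp only [toNat]
  omega

theorem Tm.toNat_bang_lt (t : Tm) : t.toNat < (bang t).toNat := by
  simp only [toNat]
  omega

theorem Fm.toNat_neg_lt (A : Fm) : A.toNat < (neg A).toNat := by
  simp only [toNat]
  omega

theorem Fm.toNat_imp_lt (A B : Fm) :
    A.toNat < (imp A B).toNat ∧ B.toNat < (imp A B).toNat := by
  have h1 := Nat.left_le_pair A.toNat B.toNat
  have h2 := Nat.right_le_pair A.toNat B.toNat
  simp only [toNat]
  omega

theorem Fm.toNat_just_lt (t : Tm) (A : Fm) :
    t.toNat < (just t A).toNat ∧ A.toNat < (just t A).toNat := by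
  have h1 := Nat.left_le_pair t.toNat A.toNat
  have h2 := Nat.right_le_pair t.toNat A.toNat
  simp only [toNat]
  omega

/-! ### Maps that respect the outermost constructors of given terms and formulae -/

/-- The map `ρ` commutes with the outermost constructor of a compound term. -/
def RespectsTm (ρ : Tm → Tm) : Tm → Prop
  | .const _ => True
  | .var _ => True
  | .app s t => ρ (.app s t) = .app (ρ s) (ρ t)
  | .sum s t => ρ (.sum s t) = .sum (ρ s) (ρ t)
  | .bang t => ρ (.bang t) = .bang (ρ t)

/-- The map `π`, together with `ρ` on terms, commutes with the outermost constructor of a compound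
formula. -/
def RespectsFm (ρ : Tm → Tm) (π : Fm → Fm) : Fm → Prop
  | .atom _ => True
  | .neg A => π (.neg A) = .neg (π A)
  | .imp A B => π (.imp A B) = .imp (π A) (π B)
  | .just t A => π (.just t A) = .just (ρ t) (π A)

/-- The maps `ρ`, `π` fix everything with a code below `N` and respect the terms in `G` and the
formulae in `F`. -/
structure Respects (N : ℕ) (G : List Tm) (F : List Fm) (ρ : Tm → Tm) (π : Fm → Fm) : Prop where
  fixTm : ∀ t : Tm, t.toNat < N → ρ t = t
  fixFm : ∀ A : Fm, A.toNat < N → π A = A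
  tm : ∀ t ∈ G, RespectsTm ρ t
  fm : ∀ A ∈ F, RespectsFm ρ π A

theorem Respects.subset {N : ℕ} {G G' : List Tm} {F F' : List Fm} {ρ : Tm → Tm} {π : Fm → Fm}
    (h : Respects N G F ρ π) (hG : G' ⊆ G) (hF : F' ⊆ F) : Respects N G' F' ρ π :=
  ⟨h.fixTm, h.fixFm, fun t ht => h.tm t (hG ht), fun A hA => h.fm A (hF hA)⟩

/-- The number of connectives of a propositional scheme. -/
def PropScheme.size : PropScheme → ℕ
  | mvar _ => 0
  | neg S => S.size + 1
  | imp S T => S.size + T.size + 1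

/-- A bound for the number of connectives and term constructors of an axiom scheme. -/
def AxScheme.size : AxScheme → ℕ
  | ofProp S => S.size
  | _ => 7

/-- One formula per connective of `S` is enough: the map has to commute only with the constructors
that the scheme itself contributes, not with those inside `σ`. -/
theorem PropScheme.exists_respects_inst (S : PropScheme) (σ : ℕ → Fm) :
    ∃ F : List Fm, F.length ≤ S.size ∧
      ∀ ρ π, (∀ A ∈ F, RespectsFm ρ π A) → π (S.inst σ) = S.inst fun i => π (σ i) := by
  induction S with
  | mvar i => exact ⟨[], by simp [size], fun _ _ _ => rfl⟩
  | neg S ih =>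
    obtain ⟨F, h1, h2⟩ := ih
    refine ⟨.neg (S.inst σ) :: F, by simpa [size] using h1, fun ρ π h => ?_⟩
    have h3 : π (.neg (S.inst σ)) = .neg (π (S.inst σ)) := h _ List.mem_cons_self
    simp only [inst, h3, h2 ρ π fun A hA => h A (List.mem_cons_of_mem _ hA)]
  | imp S T ihS ihT =>
    obtain ⟨F, h1, h2⟩ := ihS
    obtain ⟨F', h1', h2'⟩ := ihT
    refine ⟨.imp (S.inst σ) (T.inst σ) :: (F ++ F'), ?_, fun ρ π h => ?_⟩
    · simp only [List.length_cons, List.length_append, size]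
      omega
    have h3 : π (.imp (S.inst σ) (T.inst σ)) = .imp (π (S.inst σ)) (π (T.inst σ)) :=
      h _ List.mem_cons_self
    simp only [inst, h3, h2 ρ π fun A hA => h A (by simp [hA]),
      h2' ρ π fun A hA => h A (by simp [hA])]

theorem AxScheme.exists_respects_instance {N : ℕ} (hN : 0 < N) (S : AxScheme) {A : Fm}
    (hA : S.Instance A) :
    ∃ (G : List Tm) (F : List Fm), G.length + F.length ≤ S.size ∧
      ∀ ρ π, Respects N G F ρ π → S.Instance (π A) := by
  cases S with
  | ofProp S =>
    obtain ⟨σ, rfl⟩ := hA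
    obtain ⟨F, h1, h2⟩ := S.exists_respects_inst σ
    exact ⟨[], F, by simpa [size] using h1, fun ρ π h => ⟨_, h2 ρ π h.fm⟩⟩
  | app =>
    obtain ⟨s, t, A, B, rfl⟩ := hA
    refine ⟨[.app t s], [.imp (.just t (.imp A B)) (.imp (.just s A) (.just (.app t s) B)),
      .just t (.imp A B), .imp A B, .imp (.just s A) (.just (.app t s) B), .just s A,
      .just (.app t s) B], by simp [size], fun ρ π h => ⟨ρ s, ρ t, π A, π B, ?_⟩⟩
    have h1 := h.tm
    have h2 := h.fm
    simp only [List.mem_cons, List.not_mem_nil, or_false, forall_eq_or_imp, forall_eq,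
      RespectsTm, RespectsFm] at h1 h2
    obtain ⟨e1, e2, e3, e4, e5, e6⟩ := h2
    rw [e1, e2, e3, e4, e5, e6, h1]
  | sum =>
    obtain ⟨s, t, A, rfl⟩ := hA
    refine ⟨[.sum t s], [.imp (Fm.disj (.just t A) (.just s A)) (.just (.sum t s) A),
      .imp (.neg (.just t A)) (.just s A), .neg (.just t A), .just t A, .just s A,
      .just (.sum t s) A], by simp [size], fun ρ π h => ⟨ρ s, ρ t, π A, ?_⟩⟩
    have h1 := h.tm
    have h2 := h.fm
    simp only [List.mem_cons, List.not_mem_nil, or_false, forall_eq_or_imp, forall_eq,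
      RespectsTm, RespectsFm, Fm.disj] at h1 h2
    obtain ⟨e1, e2, e3, e4, e5, e6⟩ := h2
    rw [Fm.disj, e1, e2, e3, e4, e5, e6, h1, Fm.disj]
  | jd =>
    obtain ⟨t, rfl⟩ := hA
    refine ⟨[], [.imp (.just t Fm.bot) Fm.bot, .just t Fm.bot, .neg (.imp (.atom 0) (.atom 0)),
      .imp (.atom 0) (.atom 0)], by simp [size], fun ρ π h => ⟨ρ t, ?_⟩⟩
    -- The scheme (jd) mentions a particular atom, of code 0; this is where `0 < N` is needed.
    have h0 : π (.atom 0) = .atom 0 := h.fixFm _ hN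
    have h2 := h.fm
    simp only [List.mem_cons, List.not_mem_nil, or_false, forall_eq_or_imp, forall_eq,
      RespectsFm, Fm.bot] at h2
    obtain ⟨e1, e2, e3, e4⟩ := h2
    rw [Fm.bot, e1, e2, e3, e4, h0]
  | jt =>
    obtain ⟨t, A, rfl⟩ := hA
    refine ⟨[], [.imp (.just t A) A, .just t A], by simp [size],
      fun ρ π h => ⟨ρ t, π A, ?_⟩⟩
    have h2 := h.fm
    simp only [List.mem_cons, List.not_mem_nil, or_false, forall_eq_or_imp, forall_eq,
      RespectsFm] at h2
    rw [h2.1, h2.2]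
  | j4 =>
    obtain ⟨t, A, rfl⟩ := hA
    refine ⟨[.bang t], [.imp (.just t A) (.just (.bang t) (.just t A)), .just t A,
      .just (.bang t) (.just t A)], by simp [size], fun ρ π h => ⟨ρ t, π A, ?_⟩⟩
    have h1 := h.tm
    have h2 := h.fm
    simp only [List.mem_cons, List.not_mem_nil, or_false, forall_eq_or_imp, forall_eq,
      RespectsTm, RespectsFm] at h1 h2
    obtain ⟨e1, e2, e3⟩ := h2
    rw [e1, e3, e2, h1]

/-- Membership in `CS` is preserved by all maps that respect certain terms and formulae, at most `K`
for each member of `CS`. -/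
def CollapsibleCS (K : ℕ) (CS : CSet) : Prop :=
  ∀ N, 0 < N → ∀ i A, (i, A) ∈ CS → ∃ (G : List Tm) (F : List Fm), G.length + F.length ≤ K ∧
    ∀ ρ π, Respects N G F ρ π → (i, π A) ∈ CS

/-- Finitely many propositional schemes have a largest size, and each other scheme needs at most 7
constructors, the number attained by the application axiom. -/
theorem Schematic.exists_collapsible {P : Finset PropScheme} {L : JLogic} {CS : CSet}
    (h : Schematic P L CS) : ∃ K, CollapsibleCS K CS := by
  refine ⟨P.sup PropScheme.size + 7, fun N hN i A hA => ?_⟩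
  obtain ⟨𝒮, h1, h2⟩ := h i
  obtain ⟨S, hS, hSA⟩ := (h2 A).1 hA
  obtain ⟨G, F, h3, h4⟩ := S.exists_respects_instance hN hSA
  refine ⟨G, F, h3.trans ?_, fun ρ π hr => (h2 _).2 ⟨S, hS, h4 ρ π hr⟩⟩
  have h5 := h1 S hS
  cases S with
  | ofProp S =>
    have h6 : S.size ≤ P.sup PropScheme.size := Finset.le_sup h5
    simp only [AxScheme.size]
    omega
  | _ => simp [AxScheme.size]

theorem CSEvidence.exists_respects {K N : ℕ} {CS : CSet} (hCS : CollapsibleCS K CS) {t : Tm}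
    {A : Fm} (h : CSEvidence CS (fun _ => True) t A) (ht : t.toNat < N) :
    ∃ (G : List Tm) (F : List Fm), G.length + F.length ≤ K + t.toNat ∧
      ∀ ρ π, Respects N G F ρ π → CSEvidence CS (fun B => ∃ C, B = π C) t (π A) := by
  induction h with
  | const h _ =>
    obtain ⟨G, F, h1, h2⟩ := hCS N (by omega) _ _ h
    exact ⟨G, F, by omega, fun ρ π hr => .const (h2 ρ π hr) ⟨_, rfl⟩⟩
  | @bang t A _ _ ih =>
    have hlt := t.toNat_bang_lt
    obtain ⟨G, F, h1, h2⟩ := ih (by omega)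
    refine ⟨G, .just t A :: F, by simp only [List.length_cons]; omega, fun ρ π hr => ?_⟩
    have h3 : π (.just t A) = .just (ρ t) (π A) := hr.fm _ List.mem_cons_self
    have h5 : CSEvidence CS (fun B => ∃ C, B = π C) t (π A) := h2 ρ π (hr.subset (by simp) (by simp))
    rw [hr.fixTm t (by omega)] at h3
    rw [h3]
    exact .bang h5 ⟨_, h3.symm⟩

/-- Each rule strips a constructor off the term, so the derivation is bounded by `t`. Only the
leaves from `CS` and the formulae built or taken apart by a rule need to be respected. The terms
carrying the evidence are subterms of `t`, hence are fixed. -/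
theorem LeastEvidence.exists_respects {K N : ℕ} {L : JLogic} {CS : CSet} {X : Tm → Fm → Prop}
    (hCS : CollapsibleCS K CS) (hX : ∀ t A, X t A → A.toNat < N) {t : Tm} {A : Fm}
    (h : LeastEvidence L CS (fun _ => True) X t A) (ht : t.toNat < N) :
    ∃ (G : List Tm) (F : List Fm), G.length + F.length ≤ (K + 1) * (t.toNat + 1) ∧
      ∀ ρ π, Respects N G F ρ π → LeastEvidence L CS (fun B => ∃ C, B = π C) X t (π A) := by
  induction h with
  | base h _ =>
    refine ⟨[], [], by simp, fun ρ π hr => ?_⟩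
    have h1 := hr.fixFm _ (hX _ _ h)
    rw [h1]
    exact .base h ⟨_, h1.symm⟩
  | @cs t A h =>
    obtain ⟨G, F, h1, h2⟩ := h.exists_respects hCS ht
    exact ⟨G, F, by nlinarith, fun ρ π hr => .cs (h2 ρ π hr)⟩
  | @suml s t A _ ih =>
    have hlt := s.toNat_sum_lt t
    obtain ⟨G, F, h1, h2⟩ := ih (by omega)
    exact ⟨G, F, h1.trans (Nat.mul_le_mul_left _ (by omega)), fun ρ π hr => .suml (h2 ρ π hr)⟩
  | @sumr s t A _ ih =>
    have hlt := s.toNat_sum_lt t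
    obtain ⟨G, F, h1, h2⟩ := ih (by omega)
    exact ⟨G, F, h1.trans (Nat.mul_le_mul_left _ (by omega)), fun ρ π hr => .sumr (h2 ρ π hr)⟩
  | @app s t A B _ _ _ ih1 ih2 =>
    have hlt := s.toNat_app_lt t
    -- The slack of two pays for the one extra formula `A → B`: `(K+1)(s+1) + (K+1)(t+1) + 1 ≤
    -- (K+1)(s+t+3)`.
    have hlt' : s.toNat + t.toNat + 2 ≤ (Tm.app s t).toNat := by
      have h3 := Nat.add_le_pair s.toNat t.toNat
      simp only [Tm.toNat]
      omega
    obtain ⟨G, F, h1, h2⟩ := ih1 (by omega)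
    obtain ⟨G', F', h1', h2'⟩ := ih2 (by omega)
    refine ⟨G ++ G', .imp A B :: (F ++ F'), ?_, fun ρ π hr => ?_⟩
    · simp only [List.length_cons, List.length_append]
      have h3 := Nat.mul_le_mul_left (K + 1) (Nat.add_le_add_right hlt' 1)
      linarith
    have h3 : π (.imp A B) = .imp (π A) (π B) := hr.fm _ List.mem_cons_self
    have h4 : LeastEvidence L CS (fun B => ∃ C, B = π C) X s (π (.imp A B)) :=
      h2 ρ π (hr.subset (by simp) fun C hC => by simp [hC])
    rw [h3] at h4
    exact .app h4 (h2' ρ π (hr.subset (by simp) fun C hC => by simp [hC])) ⟨_, rfl⟩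
  | @bang t A hL _ _ ih =>
    have hlt := t.toNat_bang_lt
    obtain ⟨G, F, h1, h2⟩ := ih (by omega)
    refine ⟨G, .just t A :: F, ?_, fun ρ π hr => ?_⟩
    · simp only [List.length_cons]
      have h3 := Nat.mul_le_mul_left (K + 1) (Nat.succ_le_succ (Nat.succ_le_of_lt hlt))
      simp only [Nat.succ_eq_add_one] at h3
      linarith
    have h3 : π (.just t A) = .just (ρ t) (π A) := hr.fm _ List.mem_cons_self
    have h5 : LeastEvidence L CS (fun B => ∃ C, B = π C) X t (π A) :=
      h2 ρ π (hr.subset (by simp) (by simp))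
    rw [hr.fixTm t (by omega)] at h3
    rw [h3]
    exact .bang hL h5 ⟨_, h3.symm⟩

/-! ### Collapsing maps with small range -/

section Collapse

open Classical in
/-- Replace by a constant all compound subterms that neither have a code below `N` nor are in `G`. -/
noncomputable def Tm.collapse (N : ℕ) (G : Finset Tm) : Tm → Tm
  | const i => if (const i).toNat < N then const i else const 0
  | var i => if (var i).toNat < N then var i else const 0
  | app s t => if (app s t).toNat < N ∨ app s t ∈ G then
      app (s.collapse N G) (t.collapse N G) else const 0
  | sum s t => if (sum s t).toNat < N ∨ sum s t ∈ G then
      sum (s.collapse N G) (t.collapse N G) else const 0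
  | bang t => if (bang t).toNat < N ∨ bang t ∈ G then bang (t.collapse N G) else const 0

open Classical in
/-- Replace by an atom all compound subformulae that neither have a code below `N` nor are in `F`. -/
noncomputable def Fm.collapse (N : ℕ) (G : Finset Tm) (F : Finset Fm) : Fm → Fm
  | atom i => if (atom i).toNat < N then atom i else atom 0
  | neg A => if (neg A).toNat < N ∨ neg A ∈ F then neg (A.collapse N G F) else atom 0
  | imp A B => if (imp A B).toNat < N ∨ imp A B ∈ F then
      imp (A.collapse N G F) (B.collapse N G F) else atom 0
  | just t A => if (just t A).toNat < N ∨ just t A ∈ F then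
      just (t.collapse N G) (A.collapse N G F) else atom 0

theorem Tm.collapse_of_lt {N : ℕ} {G : Finset Tm} (t : Tm) (ht : t.toNat < N) :
    t.collapse N G = t := by
  induction t with
  | const i => simp [collapse, ht]
  | var i => simp [collapse, ht]
  | app s t ih1 ih2 =>
    have := s.toNat_app_lt t
    simp [collapse, ht, ih1 (by omega), ih2 (by omega)]
  | sum s t ih1 ih2 =>
    have := s.toNat_sum_lt t
    simp [collapse, ht, ih1 (by omega), ih2 (by omega)]
  | bang t ih =>
    have := t.toNat_bang_lt
    simp [collapse, ht, ih (by omega)]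

theorem Fm.collapse_of_lt {N : ℕ} {G : Finset Tm} {F : Finset Fm} (A : Fm) (hA : A.toNat < N) :
    A.collapse N G F = A := by
  induction A with
  | atom i => simp [collapse, hA]
  | neg A ih =>
    have := A.toNat_neg_lt
    simp [collapse, hA, ih (by omega)]
  | imp A B ih1 ih2 =>
    have := A.toNat_imp_lt B
    simp [collapse, hA, ih1 (by omega), ih2 (by omega)]
  | just t A ih =>
    have := toNat_just_lt t A
    simp [collapse, hA, t.collapse_of_lt (N := N) (G := G) (by omega), ih (by omega)]

open Classical in
theorem respects_collapse (N : ℕ) (G : List Tm) (F : List Fm) :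
    Respects N G F (Tm.collapse N G.toFinset) (Fm.collapse N G.toFinset F.toFinset) where
  fixTm := Tm.collapse_of_lt
  fixFm := Fm.collapse_of_lt
  tm t ht := by cases t <;> simp [RespectsTm, Tm.collapse, ht]
  fm A hA := by cases A <;> simp [RespectsFm, Fm.collapse, hA]

/-- Bounds the code of a compound term or formula by a bound for the codes of its constituents. -/
def codeStep (x : ℕ) : ℕ := 5 * ((x + 1) * (x + 1)) + 5

theorem le_codeStep_iterate (n x : ℕ) : x ≤ codeStep^[n] x :=
  Function.id_le_iterate_of_id_le (fun y => by simp only [id, codeStep]; nlinarith) n x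

theorem codeStep_iterate_mono {m n : ℕ} (h : m ≤ n) (x : ℕ) : codeStep^[m] x ≤ codeStep^[n] x :=
  Function.monotone_iterate_of_id_le (fun y => by simp only [id, codeStep]; nlinarith) h x

/-- Rests on `Nat.pair a b < (max a b + 1) ^ 2`. The form `5 * _ + 4` dominates the code of every
constructor, for terms and for formulae. -/
theorem pair_le_codeStep_iterate {a b k l m x : ℕ} (ha : a ≤ codeStep^[k] x) (hk : k < m)
    (hb : b ≤ codeStep^[l] x) (hl : l < m) : 5 * Nat.pair a b + 4 ≤ codeStep^[m] x := by
  obtain ⟨n, rfl⟩ : ∃ n, m = n + 1 := ⟨m - 1, by omega⟩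
  have ha' := ha.trans (codeStep_iterate_mono (Nat.le_of_lt_succ hk) x)
  have hb' := hb.trans (codeStep_iterate_mono (Nat.le_of_lt_succ hl) x)
  rw [Function.iterate_succ_apply']
  generalize codeStep^[n] x = y at ha' hb'
  have h1 := Nat.pair_lt_max_add_one_sq a b
  have h2 : (max a b + 1) ^ 2 ≤ (y + 1) ^ 2 := Nat.pow_le_pow_left (by omega) 2
  simp only [codeStep]
  nlinarith

theorem single_le_codeStep_iterate {a k m x : ℕ} (ha : a ≤ codeStep^[k] x) (hk : k < m) :
    5 * a + 4 ≤ codeStep^[m] x :=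
  le_trans (by have := Nat.left_le_pair a a; omega) (pair_le_codeStep_iterate ha hk ha hk)

theorem card_filter_le_lt {β : Type*} {G : Finset β} {f : β → ℕ} {n : ℕ} {b : β} (hb : b ∈ G)
    (h : n < f b) : (G.filter fun c => f c ≤ n).card < (G.filter fun c => f c ≤ f b).card :=
  Finset.card_lt_card (Finset.ssubset_iff_of_subset
    (Finset.monotone_filter_right G fun _ _ hr => hr.trans h.le) |>.2
      ⟨b, by simp [hb], by simp [hb, h]⟩)

theorem card_filter_le_mono {β : Type*} {G : Finset β} {f : β → ℕ} {m n : ℕ} (h : m ≤ n) :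
    (G.filter fun c => f c ≤ m).card ≤ (G.filter fun c => f c ≤ n).card :=
  Finset.card_le_card (Finset.monotone_filter_right G fun _ _ hr => hr.trans h)

/-- A constructor kept at code `N` or above belongs to a member of `G`, and codes fall strictly
along a branch. So each further `codeStep` is charged to a new member of `G`, and at most `G.card`
of them are nested. -/
theorem Tm.toNat_collapse_le {N : ℕ} {G : Finset Tm} (t : Tm) :
    (t.collapse N G).toNat ≤ codeStep^[(G.filter fun r => r.toNat ≤ t.toNat).card] N := by
  induction t with
  | const i =>
    refine le_trans ?_ (le_codeStep_iterate _ N)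
    rw [collapse]
    split_ifs with h
    exacts [h.le, Nat.zero_le _]
  | var i =>
    refine le_trans ?_ (le_codeStep_iterate _ N)
    rw [collapse]
    split_ifs with h
    exacts [h.le, Nat.zero_le _]
  | app s t ih1 ih2 =>
    by_cases hN : (app s t).toNat < N
    · rw [collapse_of_lt _ hN]
      exact hN.le.trans (le_codeStep_iterate _ _)
    rw [collapse]
    split_ifs with h
    · have h1 := s.toNat_app_lt t
      have h2 := h.resolve_left hN
      refine le_trans ?_ (pair_le_codeStep_iterate ih1 (card_filter_le_lt h2 h1.1) ih2
        (card_filter_le_lt h2 h1.2.1))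
      simp only [toNat]
      omega
    · exact Nat.zero_le _
  | sum s t ih1 ih2 =>
    by_cases hN : (sum s t).toNat < N
    · rw [collapse_of_lt _ hN]
      exact hN.le.trans (le_codeStep_iterate _ _)
    rw [collapse]
    split_ifs with h
    · have h1 := s.toNat_sum_lt t
      have h2 := h.resolve_left hN
      refine le_trans ?_ (pair_le_codeStep_iterate ih1 (card_filter_le_lt h2 h1.1) ih2
        (card_filter_le_lt h2 h1.2))
      simp only [toNat]
      omega
    · exact Nat.zero_le _
  | bang t ih =>
    by_cases hN : (bang t).toNat < N
    · rw [collapse_of_lt _ hN]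
      exact hN.le.trans (le_codeStep_iterate _ _)
    rw [collapse]
    split_ifs with h
    · refine le_trans ?_ (single_le_codeStep_iterate ih
        (card_filter_le_lt (h.resolve_left hN) t.toNat_bang_lt))
      simp only [toNat]
      omega
    · exact Nat.zero_le _

/-- The same charging argument, with kept formula constructors charged to `F` and kept term
constructors to `G`. -/
theorem Fm.toNat_collapse_le {N : ℕ} {G : Finset Tm} {F : Finset Fm} (A : Fm) :
    (A.collapse N G F).toNat ≤ codeStep^[(G.filter fun r => r.toNat ≤ A.toNat).card +
      (F.filter fun C => C.toNat ≤ A.toNat).card] N := by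
  induction A with
  | atom i =>
    refine le_trans ?_ (le_codeStep_iterate _ N)
    rw [collapse]
    split_ifs with h
    exacts [h.le, Nat.zero_le _]
  | neg A ih =>
    by_cases hN : (neg A).toNat < N
    · rw [collapse_of_lt _ hN]
      exact hN.le.trans (le_codeStep_iterate _ _)
    rw [collapse]
    split_ifs with h
    · have h1 := A.toNat_neg_lt
      refine le_trans ?_ (single_le_codeStep_iterate ih
        (add_lt_add_of_le_of_lt (card_filter_le_mono h1.le)
          (card_filter_le_lt (h.resolve_left hN) h1)))
      simp only [toNat]
      omega
    · exact Nat.zero_le _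
  | imp A B ih1 ih2 =>
    by_cases hN : (imp A B).toNat < N
    · rw [collapse_of_lt _ hN]
      exact hN.le.trans (le_codeStep_iterate _ _)
    rw [collapse]
    split_ifs with h
    · have h1 := A.toNat_imp_lt B
      have h2 := h.resolve_left hN
      refine le_trans ?_ (pair_le_codeStep_iterate
        ih1 (add_lt_add_of_le_of_lt (card_filter_le_mono h1.1.le) (card_filter_le_lt h2 h1.1))
        ih2 (add_lt_add_of_le_of_lt (card_filter_le_mono h1.2.le) (card_filter_le_lt h2 h1.2)))
      simp only [toNat]
      omega
    · exact Nat.zero_le _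
  | just t A ih =>
    by_cases hN : (just t A).toNat < N
    · rw [collapse_of_lt _ hN]
      exact hN.le.trans (le_codeStep_iterate _ _)
    rw [collapse]
    split_ifs with h
    · have h1 := toNat_just_lt t A
      have h2 := h.resolve_left hN
      refine le_trans ?_ (pair_le_codeStep_iterate
        t.toNat_collapse_le
        -- The term part uses members of `G` only; strictness comes from `just t A` itself, which is
        -- counted in `F`.
        (lt_of_le_of_lt (card_filter_le_mono h1.1.le)
          (Nat.lt_add_of_pos_right (Nat.zero_le _ |>.trans_lt (card_filter_le_lt h2 h1.1))))
        ih (add_lt_add_of_le_of_lt (card_filter_le_mono h1.2.le) (card_filter_le_lt h2 h1.2)))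
      simp only [toNat]
      omega
    · exact Nat.zero_le _

end Collapse

/-- A bound for the codes of the formulae needed to derive evidence for formulae and terms with
codes below `N`. -/
def evidenceBound (K N : ℕ) : ℕ := codeStep^[(K + 1) * (N + 1)] N + 1

theorem le_evidenceBound (K N : ℕ) : N ≤ evidenceBound K N :=
  (le_codeStep_iterate _ N).trans (Nat.le_succ _)

theorem leastEvidence_iff_bounded {K N : ℕ} {L : JLogic} {CS : CSet} {X : Tm → Fm → Prop}
    (hCS : CollapsibleCS K CS) (hX : ∀ t A, X t A → A.toNat < N) {t : Tm} {A : Fm}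
    (ht : t.toNat < N) (hA : A.toNat < N) :
    LeastEvidence L CS (fun _ => True) X t A ↔
      LeastEvidence L CS (fun B => B.toNat < evidenceBound K N) X t A := by
  classical
  refine ⟨fun h => ?_, fun h => h.mono (fun _ _ => trivial) fun _ _ h => h⟩
  obtain ⟨G, F, h1, h2⟩ := h.exists_respects hCS hX ht
  have h3 := h2 _ _ (respects_collapse N G F)
  -- The conclusion is fixed by the collapse, so the collapsed derivation still ends in `A`.
  rw [A.collapse_of_lt hA] at h3
  refine h3.mono ?_ fun _ _ h => h
  rintro _ ⟨B, rfl⟩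
  refine Nat.lt_succ_of_le (B.toNat_collapse_le.trans (codeStep_iterate_mono ?_ N))
  have h4 := (Finset.card_filter_le G.toFinset fun r => r.toNat ≤ B.toNat).trans
    (List.toFinset_card_le G)
  have h5 := (Finset.card_filter_le F.toFinset fun C => C.toNat ≤ B.toNat).trans
    (List.toFinset_card_le F)
  have h6 := Nat.mul_le_mul_left (K + 1) (Nat.add_le_add_right ht.le 1)
  omega

/-! ### Soundness -/

theorem PropScheme.subst_mvar (S : PropScheme) : S.subst mvar = S := by
  induction S with
  | mvar i => rfl
  | neg S ih => rw [subst, ih]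
  | imp S T ihS ihT => rw [subst, ihS, ihT]

section Soundness

variable {P : Finset PropScheme} {L : JLogic} {CS : CSet}

theorem Model.sat_inst (M : Model.{u} L CS) (w : M.W) (S : PropScheme) (σ : ℕ → Fm) :
    M.Sat (S.inst σ) w ↔ S.Eval fun i => M.Sat (σ i) w := by
  induction S with
  | mvar i => rfl
  | neg S ih => simp only [PropScheme.inst, Sat, PropScheme.Eval, ih]
  | imp S T ihS ihT => simp only [PropScheme.inst, Sat, PropScheme.Eval, ihS, ihT]

theorem Model.not_sat_bot (M : Model.{u} L CS) (w : M.W) : ¬ M.Sat Fm.bot w := by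
  simp [Fm.bot, Sat]

theorem Model.sat_just_bang (M : Model.{u} L CS) (h4 : L.Has4) {t : Tm} {A : Fm} {w : M.W}
    (h : M.Sat (.just t A) w) : M.Sat (.just (.bang t) (.just t A)) w :=
  ⟨fun _ hv => ⟨fun x hx => h.1 x (M.trans h4 _ _ _ hv hx), M.evidence.mono h4 _ _ _ _ h.2 hv⟩,
    M.evidence.bang h4 _ _ _ h.2⟩

theorem Model.sat_of_isAxiom (hP : AxiomatizesCPL P) (M : Model.{u} L CS) {A : Fm}
    (hA : IsAxiom P L A) (w : M.W) : M.Sat A w := by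
  obtain ⟨S, hS, hSA⟩ := hA
  cases S with
  | ofProp S =>
    obtain ⟨σ, rfl⟩ := hSA
    rw [M.sat_inst]
    have h := PropScheme.Derivable.ax (show S ∈ P from hS) .mvar
    rw [S.subst_mvar] at h
    exact (hP S).1 h _
  | app =>
    obtain ⟨s, t, A, B, rfl⟩ := hSA
    exact fun h1 h2 => ⟨fun v hv => h1.1 v hv (h2.1 v hv), M.evidence.app _ _ _ _ _ h1.2 h2.2⟩
  | sum =>
    obtain ⟨s, t, A, rfl⟩ := hSA
    intro h
    by_cases h1 : M.Sat (.just t A) w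
    · exact ⟨h1.1, M.evidence.sum _ _ _ _ (Or.inl h1.2)⟩
    · have h2 : M.Sat (.just s A) w := h h1
      exact ⟨h2.1, M.evidence.sum _ _ _ _ (Or.inr h2.2)⟩
  | jd =>
    obtain ⟨t, rfl⟩ := hSA
    intro h
    obtain ⟨v, hv⟩ := M.serial hS w
    exact (M.not_sat_bot v (h.1 v hv)).elim
  | jt =>
    obtain ⟨t, A, rfl⟩ := hSA
    exact fun h => h.1 w (M.refl hS w)
  | j4 =>
    obtain ⟨t, A, rfl⟩ := hSA
    exact fun h => M.sat_just_bang hS h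

theorem CSEvidence.evidence {Q : Fm → Prop} {W : Type u} {R : W → W → Prop}
    {E : Tm → Fm → W → Prop} (hE : IsEvidence L CS R E) {t : Tm} {A : Fm}
    (h : CSEvidence CS Q t A) (w : W) : E t A w := by
  by_cases h4 : L.Has4
  · induction h with
    | const h _ => exact hE.an h4 _ _ _ h
    | bang _ _ ih => exact hE.bang h4 _ _ _ ih
  · obtain ⟨i, n, B, hB, rfl, rfl⟩ := h.exists_bangs
    exact hE.anBang h4 _ _ _ hB n

theorem Model.sat_of_csEvidence (hP : AxiomatizesCPL P) (hCS : IsConstSpec P L CS)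
    (M : Model.{u} L CS) {Q : Fm → Prop} {t : Tm} {A : Fm} (h : CSEvidence CS Q t A) (w : M.W) :
    M.Sat (.just t A) w := by
  induction h generalizing w with
  | const h hQ =>
    exact ⟨fun v _ => M.sat_of_isAxiom hP (hCS _ _ h) v, (CSEvidence.const h hQ).evidence M.evidence w⟩
  | bang h hQ ih =>
    exact ⟨fun v _ => ih v, (CSEvidence.bang h hQ).evidence M.evidence w⟩

/-- The evidence rules preserve truth of `t : A`, not merely admissibility: the modal half is
carried along by normality, and by transitivity in the case of `!`. Hence truth sets are closed
under least evidence. -/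
theorem Model.sat_of_leastEvidence (hP : AxiomatizesCPL P) (hCS : IsConstSpec P L CS)
    (M : Model.{u} L CS) {Q : Fm → Prop} {X : Tm → Fm → Prop} {w : M.W}
    (hX : ∀ t A, X t A → M.Sat (.just t A) w) {t : Tm} {A : Fm}
    (h : LeastEvidence L CS Q X t A) : M.Sat (.just t A) w := by
  induction h with
  | base h _ => exact hX _ _ h
  | cs h => exact M.sat_of_csEvidence hP hCS h w
  | suml _ ih => exact ⟨ih.1, M.evidence.sum _ _ _ _ (Or.inl ih.2)⟩
  | sumr _ ih => exact ⟨ih.1, M.evidence.sum _ _ _ _ (Or.inr ih.2)⟩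
  | app _ _ _ ih1 ih2 =>
    exact ⟨fun v hv => ih1.1 v hv (ih2.1 v hv), M.evidence.app _ _ _ _ _ ih1.2 ih2.2⟩
  | bang h4 _ _ ih => exact M.sat_just_bang h4 ih

theorem Derivable.sat (hP : AxiomatizesCPL P) (hCS : IsConstSpec P L CS) {A : Fm}
    (h : Derivable P L CS A) (M : Model.{u} L CS) (w : M.W) : M.Sat A w := by
  induction h with
  | ax h => exact M.sat_of_isAxiom hP h w
  | mp _ _ ih1 ih2 => exact ih2 ih1
  | anBang n _ h => exact M.sat_of_csEvidence hP hCS (CSEvidence.of_mem h n) w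
  | an _ h => exact M.sat_of_csEvidence hP hCS (CSEvidence.of_mem h 0) w

end Soundness

/-! ### Finite certificates of satisfiability

Sets of formulae with codes below `N` are represented by the binary digits of natural numbers, and
so are sets of such sets. -/

theorem exists_testBit_iff (K : ℕ) (s : ℕ → Prop) :
    ∃ T < 2 ^ K, ∀ n, T.testBit n = true ↔ n < K ∧ s n := by
  classical
  refine ⟨Nat.ofBits fun i : Fin K => decide (s i), Nat.ofBits_lt_two_pow _, fun n => ?_⟩
  by_cases h : n < K
  · simp [h]
  · simp [h, Nat.testBit_ofBits_ge _ n (not_lt.1 h)]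

/-- The formula `A` is in the set represented by `Γ`. -/
def HasBit (Γ : ℕ) (A : Fm) : Prop := Γ.testBit A.toNat = true

/-- The evidence asserted by the members of `Γ` with codes below `N`. -/
def AssertedEvidence (N Γ : ℕ) (t : Tm) (A : Fm) : Prop :=
  (Fm.just t A).toNat < N ∧ HasBit Γ (.just t A)

/-- The set `Γ` may consist of the formulae with codes below `N` that hold at a world. -/
structure IsTruthSet (L : JLogic) (CS : CSet) (N Γ : ℕ) : Prop where
  neg : ∀ A : Fm, (Fm.neg A).toNat < N → (HasBit Γ (.neg A) ↔ ¬ HasBit Γ A)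
  imp : ∀ A B : Fm, (Fm.imp A B).toNat < N → (HasBit Γ (.imp A B) ↔ (HasBit Γ A → HasBit Γ B))
  just : ∀ t A, (Fm.just t A).toNat < N →
    (HasBit Γ (.just t A) ↔ LeastEvidence L CS (fun _ => True) (AssertedEvidence N Γ) t A)
  refl : L.HasT → ∀ t A, AssertedEvidence N Γ t A → HasBit Γ A

/-- The truth set `Δ` may belong to a world accessible from a world with truth set `Γ`. -/
def Accessible (L : JLogic) (N Γ Δ : ℕ) : Prop :=
  ∀ t A, AssertedEvidence N Γ t A → HasBit Δ A ∧ (L.Has4 → HasBit Δ (.just t A))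

/-- A set of truth sets one of which contains `A`, closed under accessibility where needed. -/
def HasCertificate (L : JLogic) (CS : CSet) (N : ℕ) (A : Fm) : Prop :=
  ∃ S < 2 ^ 2 ^ N, (∃ Γ < 2 ^ N, S.testBit Γ = true ∧ HasBit Γ A) ∧
    ∀ Γ < 2 ^ N, S.testBit Γ = true → IsTruthSet L CS N Γ ∧
      (L.HasD → ∃ Δ < 2 ^ N, S.testBit Δ = true ∧ Accessible L N Γ Δ)

section Certificates

variable {P : Finset PropScheme} {L : JLogic} {CS : CSet}

/-- Take the truth sets of all worlds of the model; there are at most `2 ^ N` of them, however many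
worlds there are. -/
theorem Satisfiable.hasCertificate (hP : AxiomatizesCPL P) (hCS : IsConstSpec P L CS) {N : ℕ}
    {A : Fm} (hA : A.toNat < N) (h : Satisfiable.{u} L CS A) : HasCertificate L CS N A := by
  obtain ⟨M, w, hw⟩ := h
  have hΓ : ∀ v : M.W, ∃ T < 2 ^ N, ∀ B : Fm, HasBit T B ↔ B.toNat < N ∧ M.Sat B v := fun v => by
    obtain ⟨T, h1, h2⟩ := exists_testBit_iff N fun n => ∃ B : Fm, B.toNat = n ∧ M.Sat B v
    refine ⟨T, h1, fun B => (h2 _).trans (and_congr_right fun _ => ?_)⟩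
    exact ⟨fun ⟨C, hC, h⟩ => Fm.toNat_injective hC ▸ h, fun h => ⟨B, rfl, h⟩⟩
  choose Γ hΓ1 hΓ2 using hΓ
  obtain ⟨S, hS1, hS2⟩ := exists_testBit_iff (2 ^ N) fun n => ∃ v, n = Γ v
  refine ⟨S, hS1, ⟨Γ w, hΓ1 w, (hS2 _).2 ⟨hΓ1 w, w, rfl⟩, (hΓ2 w A).2 ⟨hA, hw⟩⟩, ?_⟩
  rintro n hn hnS
  obtain ⟨v, rfl⟩ := ((hS2 _).1 hnS).2
  have hX : ∀ t B, AssertedEvidence N (Γ v) t B → M.Sat (.just t B) v :=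
    fun t B h => ((hΓ2 v _).1 h.2).2
  refine ⟨⟨fun B hB => ?_, fun B C hB => ?_, fun t B hB => ?_, fun hT t B hB => ?_⟩, fun hD => ?_⟩
  · have := B.toNat_neg_lt
    rw [hΓ2, hΓ2, and_iff_right hB, and_iff_right (by omega), Model.Sat]
  · have := B.toNat_imp_lt C
    rw [hΓ2, hΓ2, hΓ2, and_iff_right hB, and_iff_right (by omega), and_iff_right (by omega),
      Model.Sat]
  · exact ⟨fun h => .base ⟨hB, h⟩ trivial,
      fun h => (hΓ2 v _).2 ⟨hB, M.sat_of_leastEvidence hP hCS hX h⟩⟩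
  · exact (hΓ2 v _).2 ⟨(Fm.toNat_just_lt t B).2.trans hB.1, (hX t B hB).1 v (M.refl hT v)⟩
  · obtain ⟨x, hx⟩ := M.serial hD v
    refine ⟨Γ x, hΓ1 x, (hS2 _).2 ⟨hΓ1 x, x, rfl⟩, fun t B hB => ⟨?_, fun h4 => ?_⟩⟩
    · exact (hΓ2 x _).2 ⟨(Fm.toNat_just_lt t B).2.trans hB.1, (hX t B hB).1 x hx⟩
    · exact (hΓ2 x _).2 ⟨hB.1, (M.sat_just_bang h4 (hX t B hB)).1 x hx⟩

theorem isEvidence_leastEvidence {W : Type u} {R : W → W → Prop} {X : W → Tm → Fm → Prop}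
    (hX : L.Has4 → ∀ w v, R w v → ∀ t A, X w t A → X v t A) :
    IsEvidence L CS R fun t A w => LeastEvidence L CS (fun _ => True) (X w) t A where
  sum _ _ _ _ h := h.elim .suml .sumr
  app _ _ _ _ _ h1 h2 := .app h1 h2 trivial
  anBang _ _ _ _ h n := .cs (CSEvidence.of_mem h n)
  an _ _ _ _ h := .cs (CSEvidence.of_mem h 0)
  bang h4 _ _ _ h := .bang h4 h trivial
  mono h4 _ _ _ _ h hR := h.mono (fun _ h => h) (hX h4 _ _ hR)

/-- The truth sets themselves are the worlds, with `Accessible` as relation and least evidence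
generated by assertions. Transitivity and monotonicity hold because `Accessible` passes on `t : A`
as well as `A` under (j4). -/
theorem HasCertificate.satisfiable {N : ℕ} {A : Fm} (hA : A.toNat < N)
    (h : HasCertificate L CS N A) : Satisfiable.{u} L CS A := by
  obtain ⟨S, -, ⟨Γ₀, hΓ₀, hΓ₀S, hΓ₀A⟩, h⟩ := h
  let M : Model.{u} L CS :=
    { W := ULift.{u} {Γ : ℕ // Γ < 2 ^ N ∧ S.testBit Γ = true}
      nonempty := ⟨⟨Γ₀, hΓ₀, hΓ₀S⟩⟩
      R := fun w v => Accessible L N w.down v.down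
      trans := fun h4 w v x hwv hvx t A hA => hvx t A ⟨hA.1, (hwv t A hA).2 h4⟩
      refl := fun hT w t A hA => ⟨(h _ w.down.2.1 w.down.2.2).1.refl hT t A hA, fun _ => hA.2⟩
      serial := fun hD w => by
        obtain ⟨Δ, h1, h2, h3⟩ := (h _ w.down.2.1 w.down.2.2).2 hD
        exact ⟨⟨Δ, h1, h2⟩, h3⟩
      E := fun t A w => LeastEvidence L CS (fun _ => True) (AssertedEvidence N w.down) t A
      evidence := isEvidence_leastEvidence
        (X := fun w : ULift.{u} {Γ : ℕ // Γ < 2 ^ N ∧ S.testBit Γ = true} =>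
          AssertedEvidence N w.down)
        fun h4 w v hwv t A hA => ⟨hA.1, (hwv t A hA).2 h4⟩
      ν := fun i => {w | HasBit w.down (.atom i)} }
  have key : ∀ B : Fm, B.toNat < N → ∀ w : M.W, M.Sat B w ↔ HasBit w.down B := fun B => by
    induction B with
    | atom i => exact fun _ _ => Iff.rfl
    | neg B ih =>
      intro hB w
      have := B.toNat_neg_lt
      rw [Model.Sat, ih (by omega), (h _ w.down.2.1 w.down.2.2).1.neg _ hB]
    | imp B C ih1 ih2 =>
      intro hB w
      have := B.toNat_imp_lt C
      rw [Model.Sat, ih1 (by omega), ih2 (by omega), (h _ w.down.2.1 w.down.2.2).1.imp _ _ hB]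
    | just t B ih =>
      intro hB w
      have hlt := Fm.toNat_just_lt t B
      have hw := (h _ w.down.2.1 w.down.2.2).1.just _ _ hB
      -- Evidence alone puts `t : B` into the truth set; the modal half is needed only in the other
      -- direction, where it is built into `Accessible`.
      refine ⟨fun hs => hw.2 hs.2, fun hs => ⟨fun v hv => ?_, hw.1 hs⟩⟩
      exact (ih (by omega) v).2 (hv t B ⟨hB, hs⟩).1
  exact ⟨M, ⟨⟨Γ₀, hΓ₀, hΓ₀S⟩⟩, (key A hA _).2 hΓ₀A⟩

theorem satisfiable_iff_hasCertificate (hP : AxiomatizesCPL P) (hCS : IsConstSpec P L CS) (A : Fm) :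
    Satisfiable.{u} L CS A ↔ HasCertificate L CS (A.toNat + 1) A :=
  ⟨Satisfiable.hasCertificate hP hCS (Nat.lt_succ_self _),
    HasCertificate.satisfiable (Nat.lt_succ_self _)⟩

end Certificates

/-! ### Completeness -/

section Completeness

variable {P : Finset PropScheme} {L : JLogic} {CS : CSet}

/-- An instance of a substitution instance is again an instance of the original scheme, so schematic
derivations translate step by step. -/
theorem Derivable.of_propScheme_derivable {S : PropScheme} (h : PropScheme.Derivable P S)
    (σ : ℕ → Fm) : Derivable P L CS (S.inst σ) := by
  induction h with
  | @ax S hS τ =>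
    refine .ax ⟨.ofProp S, hS, fun i => (τ i).inst σ, ?_⟩
    clear hS
    induction S with
    | mvar i => rfl
    | neg S ih => simp only [PropScheme.subst, PropScheme.inst, ih]
    | imp S T ihS ihT => simp only [PropScheme.subst, PropScheme.inst, ihS, ihT]
  | mp _ _ ih1 ih2 => exact .mp ih1 ih2

theorem Derivable.of_tautology (hP : AxiomatizesCPL P) (S : PropScheme)
    (h : ∀ v : ℕ → Prop, S.Eval v) (σ : ℕ → Fm) : Derivable P L CS (S.inst σ) :=
  .of_propScheme_derivable ((hP S).2 h) σ

/-- Derivability in `L_CS` from a set of premises by modus ponens. -/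
inductive Entails (P : Finset PropScheme) (L : JLogic) (CS : CSet) (Γ : Set Fm) : Fm → Prop
  | prem {A : Fm} : A ∈ Γ → Entails P L CS Γ A
  | thm {A : Fm} : Derivable P L CS A → Entails P L CS Γ A
  | mp {A B : Fm} : Entails P L CS Γ A → Entails P L CS Γ (.imp A B) → Entails P L CS Γ B

theorem Entails.taut (hP : AxiomatizesCPL P) {Γ : Set Fm} (S : PropScheme)
    (h : ∀ v : ℕ → Prop, S.Eval v) (σ : ℕ → Fm) : Entails P L CS Γ (S.inst σ) :=
  .thm (.of_tautology hP S h σ)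

open PropScheme in
theorem Entails.weaken (hP : AxiomatizesCPL P) {Γ : Set Fm} {A : Fm} (B : Fm)
    (h : Entails P L CS Γ A) : Entails P L CS Γ (.imp B A) :=
  .mp h (.taut hP (.imp (mvar 0) (.imp (mvar 1) (mvar 0)))
    (fun v => by simp only [Eval]; tauto) fun i => if i = 0 then A else B)

open PropScheme in
theorem Entails.deduction (hP : AxiomatizesCPL P) {Γ : Set Fm} {A B : Fm}
    (h : Entails P L CS (insert A Γ) B) : Entails P L CS Γ (.imp A B) := by
  induction h with
  | @prem B h =>
    rcases h with rfl | h
    · exact .taut hP (.imp (mvar 0) (mvar 0)) (fun v => by simp only [Eval]; tauto) fun _ => B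
    · exact .weaken hP A (.prem h)
  | thm h => exact .weaken hP A (.thm h)
  | @mp B C _ _ ih1 ih2 =>
    exact .mp ih1 (.mp ih2 (.taut hP
      (.imp (.imp (mvar 0) (.imp (mvar 1) (mvar 2)))
        (.imp (.imp (mvar 0) (mvar 1)) (.imp (mvar 0) (mvar 2))))
      (fun v => by simp only [Eval]; tauto)
      fun i => if i = 0 then A else if i = 1 then B else C))

theorem Entails.derivable {A : Fm} (h : Entails P L CS ∅ A) : Derivable P L CS A := by
  induction h with
  | prem h => exact h.elim
  | thm h => exact h
  | mp _ _ ih1 ih2 => exact .mp ih1 ih2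

theorem Entails.mono {Γ Δ : Set Fm} (h : Γ ⊆ Δ) {A : Fm} (hA : Entails P L CS Γ A) :
    Entails P L CS Δ A := by
  induction hA with
  | prem hA => exact .prem (h hA)
  | thm hA => exact .thm hA
  | mp _ _ ih1 ih2 => exact .mp ih1 ih2

theorem Entails.exists_of_sUnion {c : Set (Set Fm)} (hc : IsChain (· ⊆ ·) c) (hne : c.Nonempty)
    {A : Fm} (h : Entails P L CS (⋃₀ c) A) : ∃ Γ ∈ c, Entails P L CS Γ A := by
  induction h with
  | prem h =>
    obtain ⟨Γ, hΓ, hA⟩ := h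
    exact ⟨Γ, hΓ, .prem hA⟩
  | thm h => exact ⟨_, hne.some_mem, .thm h⟩
  | mp _ _ ih1 ih2 =>
    obtain ⟨Γ, hΓ, h1⟩ := ih1
    obtain ⟨Δ, hΔ, h2⟩ := ih2
    rcases hc.total hΓ hΔ with h | h
    · exact ⟨Δ, hΔ, .mp (h1.mono h) h2⟩
    · exact ⟨Γ, hΓ, .mp h1 (h2.mono h)⟩

/-- Consistency with respect to `L_CS`. -/
def Consistent (P : Finset PropScheme) (L : JLogic) (CS : CSet) (Γ : Set Fm) : Prop :=
  ¬ Entails P L CS Γ Fm.bot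

/-- Maximal consistency with respect to `L_CS`. -/
def MaxConsistent (P : Finset PropScheme) (L : JLogic) (CS : CSet) (Γ : Set Fm) : Prop :=
  Maximal (Consistent P L CS) Γ

theorem Consistent.exists_maxConsistent {Γ : Set Fm} (h : Consistent P L CS Γ) :
    ∃ Δ, Γ ⊆ Δ ∧ MaxConsistent P L CS Δ := by
  refine zorn_subset_nonempty {Δ | Consistent P L CS Δ} (fun c hc hchain hne => ?_) Γ h
  refine ⟨⋃₀ c, fun hbot => ?_, fun s hs => Set.subset_sUnion_of_mem hs⟩
  obtain ⟨Δ, hΔ, h⟩ := hbot.exists_of_sUnion hchain hne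
  exact hc hΔ h

/-- If adding `A` led to `⊥`, the deduction theorem would give `A → ⊥` from `Γ`, and so `⊥`;
maximality then puts `A` into `Γ`. -/
theorem MaxConsistent.mem_of_entails (hP : AxiomatizesCPL P) {Γ : Set Fm}
    (hΓ : MaxConsistent P L CS Γ) {A : Fm} (h : Entails P L CS Γ A) : A ∈ Γ :=
  hΓ.2 (fun hbot => hΓ.1 (.mp h (hbot.deduction hP))) (Set.subset_insert A Γ)
    (Set.mem_insert A Γ)

open PropScheme in
theorem Entails.explode (hP : AxiomatizesCPL P) {Γ : Set Fm} {A B : Fm}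
    (h : Entails P L CS Γ A) (h' : Entails P L CS Γ (.neg A)) : Entails P L CS Γ B :=
  .mp h' (.mp h (.taut hP (.imp (mvar 0) (.imp (.neg (mvar 0)) (mvar 1)))
    (fun v => by simp only [Eval]; tauto) fun i => if i = 0 then A else B))

open PropScheme in
theorem Entails.neg_of_insert (hP : AxiomatizesCPL P) {Γ : Set Fm} {A : Fm}
    (h : Entails P L CS (insert A Γ) Fm.bot) : Entails P L CS Γ (.neg A) :=
  .mp (h.deduction hP) (.taut hP
    -- `mvar 0` stands for `p₀`, so that the scheme matches `⊥ = ¬(p₀ → p₀)`.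
    (.imp (.imp (mvar 1) (.neg (.imp (mvar 0) (mvar 0)))) (.neg (mvar 1)))
    (fun v => by simp only [Eval]; tauto) fun i => if i = 0 then .atom 0 else A)

theorem MaxConsistent.neg_mem (hP : AxiomatizesCPL P) {Γ : Set Fm}
    (hΓ : MaxConsistent P L CS Γ) (A : Fm) : .neg A ∈ Γ ↔ A ∉ Γ := by
  refine ⟨fun h h' => hΓ.1 (.explode hP (.prem h') (.prem h)), fun h => ?_⟩
  refine hΓ.mem_of_entails hP (.neg_of_insert hP (by_contra fun hc => h ?_))
  exact hΓ.2 hc (Set.subset_insert A Γ) (Set.mem_insert A Γ)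

theorem MaxConsistent.imp_mem (hP : AxiomatizesCPL P) {Γ : Set Fm}
    (hΓ : MaxConsistent P L CS Γ) (A B : Fm) : .imp A B ∈ Γ ↔ (A ∈ Γ → B ∈ Γ) := by
  refine ⟨fun h h' => hΓ.mem_of_entails hP (.mp (.prem h') (.prem h)), fun h => ?_⟩
  refine hΓ.mem_of_entails hP (Entails.deduction hP ?_)
  by_cases hA : A ∈ Γ
  · exact .prem (Set.mem_insert_of_mem _ (h hA))
  · exact .explode hP (.prem (Set.mem_insert A Γ))
      (.prem (Set.mem_insert_of_mem _ ((hΓ.neg_mem hP A).2 hA)))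

theorem MaxConsistent.mem_of_scheme (hP : AxiomatizesCPL P) {Γ : Set Fm}
    (hΓ : MaxConsistent P L CS Γ) (S : AxScheme) (hS : S.Of P L) {A B : Fm}
    (h : S.Instance (.imp A B)) (hA : A ∈ Γ) : B ∈ Γ :=
  hΓ.mem_of_entails hP (.mp (.prem hA) (.thm (.ax ⟨S, hS, h⟩)))

theorem MaxConsistent.app_mem (hP : AxiomatizesCPL P) {Γ : Set Fm}
    (hΓ : MaxConsistent P L CS Γ) {s t : Tm} {A B : Fm} (h1 : .just s (.imp A B) ∈ Γ)
    (h2 : .just t A ∈ Γ) : .just (.app s t) B ∈ Γ :=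
  (hΓ.imp_mem hP _ _).1 (hΓ.mem_of_scheme hP .app trivial ⟨t, s, A, B, rfl⟩ h1) h2

theorem MaxConsistent.bang_mem (hP : AxiomatizesCPL P) {Γ : Set Fm}
    (hΓ : MaxConsistent P L CS Γ) (h4 : L.Has4) {t : Tm} {A : Fm} (h : .just t A ∈ Γ) :
    .just (.bang t) (.just t A) ∈ Γ :=
  hΓ.mem_of_scheme hP .j4 h4 ⟨t, A, rfl⟩ h

/-- Internalization: theorems have justifications when all axioms have. -/
theorem Derivable.exists_just (hCS : AxiomaticallyAppropriate P L CS) {A : Fm}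
    (h : Derivable P L CS A) : ∃ t, Derivable P L CS (.just t A) := by
  induction h with
  | ax h =>
    obtain ⟨i, hi⟩ := hCS _ h
    by_cases h4 : L.Has4
    · exact ⟨_, .an h4 hi⟩
    · exact ⟨_, .anBang 0 h4 hi⟩
  | @mp A B _ _ ih1 ih2 =>
    obtain ⟨t, ht⟩ := ih1
    obtain ⟨s, hs⟩ := ih2
    exact ⟨.app s t, .mp ht (.mp hs (.ax ⟨.app, trivial, t, s, A, B, rfl⟩))⟩
  | anBang n h4 h => exact ⟨_, .anBang (n + 1) h4 h⟩
  | @an i A h4 h => exact ⟨_, .mp (.an h4 h) (.ax ⟨.j4, h4, .const i, A, rfl⟩)⟩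

/-- The formulae justified in `Γ` are closed under consequence: theorems enter by internalization,
modus ponens by the application axiom. -/
theorem MaxConsistent.exists_just_mem (hP : AxiomatizesCPL P)
    (hCS : AxiomaticallyAppropriate P L CS) {Γ : Set Fm} (hΓ : MaxConsistent P L CS Γ) {A : Fm}
    (h : Entails P L CS {B | ∃ t, .just t B ∈ Γ} A) : ∃ t, .just t A ∈ Γ := by
  induction h with
  | prem h => exact h
  | thm h =>
    obtain ⟨t, ht⟩ := h.exists_just hCS
    exact ⟨t, hΓ.mem_of_entails hP (.thm ht)⟩
  | mp _ _ ih1 ih2 =>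
    obtain ⟨t, ht⟩ := ih1
    obtain ⟨s, hs⟩ := ih2
    exact ⟨_, hΓ.app_mem hP hs ht⟩

/-- Were the formulae justified in `Γ` inconsistent, some `t : ⊥` would be in `Γ`, against (jd). -/
theorem MaxConsistent.exists_accessible (hP : AxiomatizesCPL P)
    (hCS : AxiomaticallyAppropriate P L CS) (hD : L.HasD) {Γ : Set Fm}
    (hΓ : MaxConsistent P L CS Γ) :
    ∃ Δ, MaxConsistent P L CS Δ ∧ ∀ t B, .just t B ∈ Γ → B ∈ Δ := by
  have h : Consistent P L CS {B | ∃ t, .just t B ∈ Γ} := fun hbot => by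
    obtain ⟨t, ht⟩ := hΓ.exists_just_mem hP hCS hbot
    exact hΓ.1 (.prem (hΓ.mem_of_scheme hP .jd hD ⟨t, rfl⟩ ht))
  obtain ⟨Δ, h1, h2⟩ := h.exists_maxConsistent
  exact ⟨Δ, h2, fun t B hB => h1 ⟨t, hB⟩⟩

theorem MaxConsistent.isEvidence (hP : AxiomatizesCPL P) {W : Type u} {T : W → Set Fm}
    (hT : ∀ w, MaxConsistent P L CS (T w)) :
    IsEvidence L CS (fun w v => ∀ t B, .just t B ∈ T w → B ∈ T v)
      fun t A w => .just t A ∈ T w where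
  sum s t A w h := by
    refine (hT w).mem_of_scheme hP .sum trivial ⟨t, s, A, rfl⟩ ?_
    rw [Fm.disj, (hT w).imp_mem hP, (hT w).neg_mem hP]
    tauto
  app s t A B w h1 h2 := (hT w).app_mem hP h1 h2
  anBang h4 i A w h n := (hT w).mem_of_entails hP (.thm (.anBang n h4 h))
  an h4 i A w h := (hT w).mem_of_entails hP (.thm (.an h4 h))
  bang h4 t A w h := (hT w).bang_mem hP h4 h
  mono h4 t A w v h hR := hR _ _ ((hT w).bang_mem hP h4 h)

/-- Canonical model: worlds are the maximal consistent sets, and `t` is evidence for `B` exactly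
where `t : B` is a member. The truth lemma needs no existence argument for the modal case, as
evidence already decides membership. -/
theorem Consistent.satisfiable (hP : AxiomatizesCPL P)
    (hCS : L.HasD → AxiomaticallyAppropriate P L CS) {A : Fm} (hA : Consistent P L CS {A}) :
    Satisfiable.{u} L CS A := by
  obtain ⟨Γ₀, hAΓ₀, hΓ₀⟩ := hA.exists_maxConsistent
  let M : Model.{u} L CS :=
    { W := ULift.{u} {Γ : Set Fm // MaxConsistent P L CS Γ}
      nonempty := ⟨⟨Γ₀, hΓ₀⟩⟩
      R := fun w v => ∀ t B, .just t B ∈ w.down.1 → B ∈ v.down.1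
      trans := fun h4 w v x hwv hvx t B hB => hvx t B (hwv _ _ (w.down.2.bang_mem hP h4 hB))
      refl := fun hT w t B hB => w.down.2.mem_of_scheme hP .jt hT ⟨t, B, rfl⟩ hB
      serial := fun hD w => by
        obtain ⟨Δ, h1, h2⟩ := w.down.2.exists_accessible hP (hCS hD) hD
        exact ⟨⟨Δ, h1⟩, h2⟩
      E := fun t B w => .just t B ∈ w.down.1
      evidence := MaxConsistent.isEvidence hP fun w => w.down.2
      ν := fun i => {w | .atom i ∈ w.down.1} }
  have key : ∀ B : Fm, ∀ w : M.W, M.Sat B w ↔ B ∈ w.down.1 := fun B => by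
    induction B with
    | atom i => exact fun _ => Iff.rfl
    | neg B ih => intro w; rw [Model.Sat, ih, w.down.2.neg_mem hP]
    | imp B C ih1 ih2 => intro w; rw [Model.Sat, ih1, ih2, w.down.2.imp_mem hP]
    | just t B ih =>
      exact fun w => ⟨fun h => h.2, fun h => ⟨fun v hv => (ih v).2 (hv t B h), h⟩⟩
  exact ⟨M, ⟨⟨Γ₀, hΓ₀⟩⟩, (key A _).2 (hAΓ₀ rfl)⟩

open PropScheme in
theorem derivable_iff_not_satisfiable_neg (hP : AxiomatizesCPL P) (hCS : IsConstSpec P L CS)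
    (hD : L.HasD → AxiomaticallyAppropriate P L CS) (A : Fm) :
    Derivable P L CS A ↔ ¬ Satisfiable.{u} L CS (.neg A) := by
  refine ⟨fun h ⟨M, w, hw⟩ => hw (h.sat hP hCS M w), fun h => by_contra fun hA => h ?_⟩
  refine Consistent.satisfiable hP hD fun hbot => hA ?_
  have h1 : Entails P L CS ∅ (.neg (.neg A)) :=
    Entails.neg_of_insert hP (by rwa [insert_empty_eq])
  exact (Entails.mp h1 (.taut hP (.imp (.neg (.neg (mvar 0))) (mvar 0))
    (fun v => by simp only [Eval]; tauto) fun _ => A)).derivable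

end Completeness

/-! ### Decidability of least evidence -/

open Encodable

/-- The pair `(t, A)` is in the set represented by `T`. -/
def PairBit (T : ℕ) (t : Tm) (A : Fm) : Prop := T.testBit (Nat.pair (encode t) (encode A)) = true

/-- Everything in `U` with codes below `N` and `M` comes from the constant specification. -/
def CSJustified (CS : CSet) (N M U : ℕ) : Prop :=
  ∀ t : Tm, encode t < N → ∀ A : Fm, encode A < M → PairBit U t A →
    (∃ i : ℕ, encode i < N ∧ t = .const i ∧ (i, A) ∈ CS) ∨
    (∃ s : Tm, encode s < N ∧ ∃ B : Fm, encode B < M ∧ t = .bang s ∧ A = .just s B ∧ PairBit U s B)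

/-- Everything in `T` with codes below `N` and `M` is asserted by `Γ`, in `U` or the conclusion of a
closure rule for evidence with premises in `T`. -/
def Justified (L : JLogic) (N M Γ U T : ℕ) : Prop :=
  ∀ t : Tm, encode t < N → ∀ A : Fm, encode A < M → PairBit T t A →
    AssertedEvidence N Γ t A ∨ PairBit U t A ∨
    (∃ r : Tm, encode r < N ∧ ∃ s : Tm, encode s < N ∧
      t = .sum r s ∧ (PairBit T r A ∨ PairBit T s A)) ∨
    (∃ r : Tm, encode r < N ∧ ∃ s : Tm, encode s < N ∧ ∃ B : Fm, encode B < M ∧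
      t = .app r s ∧ encode (Fm.imp B A) < M ∧ PairBit T r (.imp B A) ∧ PairBit T s B) ∨
    (L.Has4 ∧ ∃ s : Tm, encode s < N ∧ ∃ B : Fm, encode B < M ∧
      t = .bang s ∧ A = .just s B ∧ PairBit T s B)

theorem exists_pairBit_iff {N M : ℕ} (h : N ≤ M) (s : Tm → Fm → Prop) :
    ∃ T < 2 ^ ((M + 1) * (M + 1)), ∀ t A, encode t < N → encode A < M →
      (PairBit T t A ↔ s t A) := by
  obtain ⟨T, h1, h2⟩ := exists_testBit_iff ((M + 1) * (M + 1))
    fun n => ∃ t A, n = Nat.pair (encode t) (encode A) ∧ s t A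
  refine ⟨T, h1, fun t A ht hA => (h2 _).trans ⟨?_, fun hs => ⟨?_, t, A, rfl, hs⟩⟩⟩
  · rintro ⟨-, t', A', he, hs⟩
    obtain ⟨h3, h4⟩ := Nat.pair_eq_pair.1 he
    rwa [encode_injective h3, encode_injective h4]
  · refine (Nat.pair_lt_max_add_one_sq _ _).trans_le ?_
    -- Both codes are below `M`, so pairs of them lie below `(M + 1) ^ 2`.
    rw [sq]
    exact Nat.mul_le_mul (by omega) (by omega)

theorem CSJustified.csEvidence {CS : CSet} {N M U : ℕ} (h : CSJustified CS N M U) {t : Tm}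
    (ht : encode t < N) {A : Fm} (hA : encode A < M) (hU : PairBit U t A) :
    CSEvidence CS (fun B => B.toNat < M) t A := by
  induction t generalizing A with
  | bang t ih =>
    rcases h _ ht A hA hU with ⟨i, -, h1, -⟩ | ⟨s, hs, B, hB, h1, rfl, h2⟩
    · cases h1
    · cases h1
      exact .bang (ih hs hB h2) hA
  | _ =>
    rcases h _ ht A hA hU with ⟨i, -, h1, h2⟩ | ⟨s, -, B, -, h1, -⟩ <;> cases h1 <;>
      exact .const h2 hA

/-- Justifications cannot be circular, since each rule passes to proper subterms; so mutual
justification within `T` unwinds by induction on `t`. -/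
theorem Justified.leastEvidence {L : JLogic} {CS : CSet} {N M Γ U T : ℕ}
    (hcs : CSJustified CS N M U) (h : Justified L N M Γ U T) {t : Tm}
    (ht : encode t < N) {A : Fm} (hA : encode A < M) (hT : PairBit T t A) :
    LeastEvidence L CS (fun B => B.toNat < M) (AssertedEvidence N Γ) t A := by
  induction t generalizing A with
  | const i =>
    rcases h _ ht A hA hT with h1 | h1 | ⟨_, _, _, _, h1, _⟩ | ⟨_, _, _, _, _, _, h1, _⟩ |
      ⟨_, _, _, _, _, h1, _⟩
    · exact .base h1 hA
    · exact .cs (hcs.csEvidence ht hA h1)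
    all_goals cases h1
  | var i =>
    rcases h _ ht A hA hT with h1 | h1 | ⟨_, _, _, _, h1, _⟩ | ⟨_, _, _, _, _, _, h1, _⟩ |
      ⟨_, _, _, _, _, h1, _⟩
    · exact .base h1 hA
    · exact .cs (hcs.csEvidence ht hA h1)
    all_goals cases h1
  | app r s ih1 ih2 =>
    rcases h _ ht A hA hT with h1 | h1 | ⟨_, _, _, _, h1, _⟩ | ⟨_, hr, _, hs, _, hB, h1, hi, h2, h3⟩ |
      ⟨_, _, _, _, _, h1, _⟩
    · exact .base h1 hA
    · exact .cs (hcs.csEvidence ht hA h1)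
    all_goals cases h1
    exact .app (ih1 hr hi h2) (ih2 hs hB h3) hA
  | sum r s ih1 ih2 =>
    rcases h _ ht A hA hT with h1 | h1 | ⟨_, hr, _, hs, h1, h2⟩ | ⟨_, _, _, _, _, _, h1, _⟩ |
      ⟨_, _, _, _, _, h1, _⟩
    · exact .base h1 hA
    · exact .cs (hcs.csEvidence ht hA h1)
    all_goals cases h1
    exact h2.elim (fun h2 => .suml (ih1 hr hA h2)) fun h2 => .sumr (ih2 hs hA h2)
  | bang s ih =>
    rcases h _ ht A hA hT with h1 | h1 | ⟨_, _, _, _, h1, _⟩ | ⟨_, _, _, _, _, _, h1, _⟩ |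
      ⟨h4, _, hs, _, hB, h1, rfl, h2⟩
    · exact .base h1 hA
    · exact .cs (hcs.csEvidence ht hA h1)
    all_goals cases h1
    exact .bang h4 (ih hs hB h2) hA

/-- The full bounded relations are self-justifying sets, and every self-justifying set is contained
in them. Two sets are guessed because evidence from `CS` may use `!` even without (j4), but only on
top of evidence from `CS`. -/
theorem leastEvidence_iff_justified {L : JLogic} {CS : CSet} {N M Γ : ℕ} (hNM : N ≤ M) {t : Tm}
    {A : Fm} (ht : t.toNat < N) (hA : A.toNat < M) :
    LeastEvidence L CS (fun B => B.toNat < M) (AssertedEvidence N Γ) t A ↔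
      ∃ U, U < 2 ^ ((M + 1) * (M + 1)) ∧ ∃ T, T < 2 ^ ((M + 1) * (M + 1)) ∧
        CSJustified CS N M U ∧ Justified L N M Γ U T ∧ PairBit T t A := by
  constructor
  · intro h
    obtain ⟨U, hU, hU'⟩ := exists_pairBit_iff hNM (CSEvidence CS fun B => B.toNat < M)
    obtain ⟨T, hT, hT'⟩ := exists_pairBit_iff hNM
      (LeastEvidence L CS (fun B => B.toNat < M) (AssertedEvidence N Γ))
    refine ⟨U, hU, T, hT, fun t ht A hA htA => ?_, fun t ht A hA htA => ?_, (hT' t A ht hA).2 h⟩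
    · rw [hU' t A ht hA] at htA
      cases htA with
      | @const i A h _ =>
        refine Or.inl ⟨i, lt_of_le_of_lt ?_ ht, rfl, h⟩
        simp only [Tm.encode_eq, Tm.toNat, encode_nat]
        omega
      | @bang s B h _ =>
        have h1 : encode s < N := s.toNat_bang_lt.trans ht
        have h2 : encode B < M := (Fm.toNat_just_lt s B).2.trans hA
        exact Or.inr ⟨s, h1, B, h2, rfl, rfl, (hU' s B h1 h2).2 h⟩
    · rw [hT' t A ht hA] at htA
      cases htA with
      | base h => exact Or.inl h
      | cs h => exact Or.inr (Or.inl ((hU' t A ht hA).2 h))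
      | @suml r s _ h =>
        have hr : encode r < N := (r.toNat_sum_lt s).1.trans ht
        have hs : encode s < N := (r.toNat_sum_lt s).2.trans ht
        exact Or.inr (Or.inr (Or.inl ⟨r, hr, s, hs, rfl, Or.inl ((hT' r A hr hA).2 h)⟩))
      | @sumr r s _ h =>
        have hr : encode r < N := (r.toNat_sum_lt s).1.trans ht
        have hs : encode s < N := (r.toNat_sum_lt s).2.trans ht
        exact Or.inr (Or.inr (Or.inl ⟨r, hr, s, hs, rfl, Or.inr ((hT' s A hs hA).2 h)⟩))
      | @app r s B _ h1 h2 =>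
        have hr : encode r < N := (r.toNat_app_lt s).1.trans ht
        have hs : encode s < N := (r.toNat_app_lt s).2.1.trans ht
        exact Or.inr (Or.inr (Or.inr (Or.inl ⟨r, hr, s, hs, B, h2.prop, rfl, h1.prop,
          (hT' r _ hr h1.prop).2 h1, (hT' s B hs h2.prop).2 h2⟩)))
      | @bang s B h4 h =>
        have hs : encode s < N := s.toNat_bang_lt.trans ht
        exact Or.inr (Or.inr (Or.inr (Or.inr ⟨h4, s, hs, B, h.prop, rfl, rfl,
          (hT' s B hs h.prop).2 h⟩)))
  · rintro ⟨U, -, T, -, h1, h2, h3⟩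
    exact h2.leastEvidence h1 ht hA h3

/-! ### Computability of the evidence relation and of certificates -/

section Computability

variable {α : Type*} [Primcodable α]

theorem computable_evidenceBound (K : ℕ) {N : α → ℕ} (hN : Computable N) :
    Computable fun a => evidenceBound K (N a) := by
  have h1 : Primrec fun x : ℕ => codeStep x := by
    have h2 : Primrec fun x : ℕ => x + 1 := Primrec.succ
    exact Primrec.nat_add.comp (Primrec.nat_mul.comp (Primrec.const 5)
      (Primrec.nat_mul.comp h2 h2)) (Primrec.const 5)
  have h2 : Primrec fun n : ℕ => (K + 1) * (n + 1) :=
    Primrec.nat_mul.comp (Primrec.const (K + 1)) Primrec.succ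
  have h3 : Primrec fun n : ℕ => codeStep^[(K + 1) * (n + 1)] n :=
    Primrec.nat_iterate h2 Primrec.id (h1.comp Primrec.snd).to₂
  exact (Primrec.succ.comp h3).to_comp.comp hN

theorem computablePred_hasBit {Γ : α → ℕ} {A : α → Fm} (hΓ : Computable Γ) (hA : Computable A) :
    ComputablePred fun a => HasBit (Γ a) (A a) :=
  ComputablePred.testBit hΓ (computable_encode hA)

theorem computablePred_pairBit {T : α → ℕ} {t : α → Tm} {A : α → Fm} (hT : Computable T)
    (ht : Computable t) (hA : Computable A) : ComputablePred fun a => PairBit (T a) (t a) (A a) :=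
  ComputablePred.testBit hT
    (Primrec₂.natPair.to_comp.comp (computable_encode ht) (computable_encode hA))

theorem computablePred_assertedEvidence {N Γ : α → ℕ} {t : α → Tm} {A : α → Fm}
    (hN : Computable N) (hΓ : Computable Γ) (ht : Computable t) (hA : Computable A) :
    ComputablePred fun a => AssertedEvidence (N a) (Γ a) (t a) (A a) :=
  ComputablePred.and' (ComputablePred.lt' (computable_encode (computable_just ht hA)) hN)
    (computablePred_hasBit hΓ (computable_just ht hA))

theorem computablePred_exists_bang {N M T : α → ℕ} {t : α → Tm} {A : α → Fm} (hN : Computable N)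
    (hM : Computable M) (hT : Computable T) (ht : Computable t) (hA : Computable A) :
    ComputablePred fun a => ∃ s : Tm, encode s < N a ∧ ∃ B : Fm, encode B < M a ∧
      t a = .bang s ∧ A a = .just s B ∧ PairBit (T a) s B := by
  refine ComputablePred.exists_lt hN (ComputablePred.exists_lt (hM.comp .fst) ?_)
  have ha : Computable fun q : (α × Tm) × Fm => q.1.1 := Computable.fst.comp .fst
  have hs : Computable fun q : (α × Tm) × Fm => q.1.2 := Computable.snd.comp .fst
  have hB : Computable fun q : (α × Tm) × Fm => q.2 := Computable.snd
  exact ComputablePred.and' (ComputablePred.eq' (ht.comp ha) (computable_bang hs))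
    (ComputablePred.and' (ComputablePred.eq' (hA.comp ha) (computable_just hs hB))
      (computablePred_pairBit (hT.comp ha) hs hB))

theorem computablePred_exists_sum {N T : α → ℕ} {t : α → Tm} {A : α → Fm} (hN : Computable N)
    (hT : Computable T) (ht : Computable t) (hA : Computable A) :
    ComputablePred fun a => ∃ r : Tm, encode r < N a ∧ ∃ s : Tm, encode s < N a ∧
      t a = .sum r s ∧ (PairBit (T a) r (A a) ∨ PairBit (T a) s (A a)) := by
  refine ComputablePred.exists_lt hN (ComputablePred.exists_lt (hN.comp .fst) ?_)
  have ha : Computable fun q : (α × Tm) × Tm => q.1.1 := Computable.fst.comp .fst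
  have hr : Computable fun q : (α × Tm) × Tm => q.1.2 := Computable.snd.comp .fst
  have hs : Computable fun q : (α × Tm) × Tm => q.2 := Computable.snd
  exact ComputablePred.and' (ComputablePred.eq' (ht.comp ha) (computable_sum hr hs))
    (ComputablePred.or' (computablePred_pairBit (hT.comp ha) hr (hA.comp ha))
      (computablePred_pairBit (hT.comp ha) hs (hA.comp ha)))

theorem computablePred_exists_app {N M T : α → ℕ} {t : α → Tm} {A : α → Fm} (hN : Computable N)
    (hM : Computable M) (hT : Computable T) (ht : Computable t) (hA : Computable A) :
    ComputablePred fun a => ∃ r : Tm, encode r < N a ∧ ∃ s : Tm, encode s < N a ∧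
      ∃ B : Fm, encode B < M a ∧ t a = .app r s ∧ encode (Fm.imp B (A a)) < M a ∧
        PairBit (T a) r (.imp B (A a)) ∧ PairBit (T a) s B := by
  refine ComputablePred.exists_lt hN (ComputablePred.exists_lt (hN.comp .fst)
    (ComputablePred.exists_lt (hM.comp (Computable.fst.comp .fst)) ?_))
  have ha : Computable fun q : ((α × Tm) × Tm) × Fm => q.1.1.1 :=
    Computable.fst.comp (Computable.fst.comp .fst)
  have hr : Computable fun q : ((α × Tm) × Tm) × Fm => q.1.1.2 :=
    Computable.snd.comp (Computable.fst.comp .fst)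
  have hs : Computable fun q : ((α × Tm) × Tm) × Fm => q.1.2 := Computable.snd.comp .fst
  have hB : Computable fun q : ((α × Tm) × Tm) × Fm => q.2 := Computable.snd
  have hi := computable_imp hB (hA.comp ha)
  exact ComputablePred.and' (ComputablePred.eq' (ht.comp ha) (computable_app hr hs))
    (ComputablePred.and' (ComputablePred.lt' (computable_encode hi) (hM.comp ha))
      (ComputablePred.and' (computablePred_pairBit (hT.comp ha) hr hi)
        (computablePred_pairBit (hT.comp ha) hs hB)))

theorem computablePred_csJustified {CS : CSet} (hCS : DecidableCS CS) {N M U : α → ℕ}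
    (hN : Computable N) (hM : Computable M) (hU : Computable U) :
    ComputablePred fun a => CSJustified CS (N a) (M a) (U a) := by
  refine ComputablePred.forall_lt hN (ComputablePred.forall_lt (hM.comp .fst) ?_)
  have ha : Computable fun q : (α × Tm) × Fm => q.1.1 := Computable.fst.comp .fst
  have ht : Computable fun q : (α × Tm) × Fm => q.1.2 := Computable.snd.comp .fst
  have hA : Computable fun q : (α × Tm) × Fm => q.2 := Computable.snd
  refine ComputablePred.imp' (computablePred_pairBit (hU.comp ha) ht hA) (ComputablePred.or'
    (ComputablePred.exists_lt (hN.comp ha) (ComputablePred.and' ?_ ?_))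
    (computablePred_exists_bang (hN.comp ha) (hM.comp ha) (hU.comp ha) ht hA))
  · exact ComputablePred.eq' (ht.comp .fst) (computable_const .snd)
  · exact ComputablePred.comp' hCS (Computable.snd.pair (hA.comp .fst))

theorem computablePred_justified (L : JLogic) {N M Γ U T : α → ℕ} (hN : Computable N)
    (hM : Computable M) (hΓ : Computable Γ) (hU : Computable U) (hT : Computable T) :
    ComputablePred fun a => Justified L (N a) (M a) (Γ a) (U a) (T a) := by
  refine ComputablePred.forall_lt hN (ComputablePred.forall_lt (hM.comp .fst) ?_)
  have ha : Computable fun q : (α × Tm) × Fm => q.1.1 := Computable.fst.comp .fst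
  have ht : Computable fun q : (α × Tm) × Fm => q.1.2 := Computable.snd.comp .fst
  have hA : Computable fun q : (α × Tm) × Fm => q.2 := Computable.snd
  exact ComputablePred.imp' (computablePred_pairBit (hT.comp ha) ht hA)
    (ComputablePred.or' (computablePred_assertedEvidence (hN.comp ha) (hΓ.comp ha) ht hA)
    (ComputablePred.or' (computablePred_pairBit (hU.comp ha) ht hA)
    (ComputablePred.or' (computablePred_exists_sum (hN.comp ha) (hT.comp ha) ht hA)
    (ComputablePred.or'
      (computablePred_exists_app (hN.comp ha) (hM.comp ha) (hT.comp ha) ht hA)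
      (ComputablePred.and' (ComputablePred.const' L.Has4)
        (computablePred_exists_bang (hN.comp ha) (hM.comp ha) (hT.comp ha) ht hA))))))

/-- The conjunct on the code of `t : A` places `t` and `A` below `N`, where the collapse bound and
the finite search apply. -/
theorem computablePred_leastEvidence {K : ℕ} {L : JLogic} {CS : CSet} (hCS : DecidableCS CS)
    (hK : CollapsibleCS K CS) {N Γ : α → ℕ} {t : α → Tm} {A : α → Fm} (hN : Computable N)
    (hΓ : Computable Γ) (ht : Computable t) (hA : Computable A) :
    ComputablePred fun a => (Fm.just (t a) (A a)).toNat < N a ∧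
      LeastEvidence L CS (fun _ => True) (AssertedEvidence (N a) (Γ a)) (t a) (A a) := by
  have hM := computable_evidenceBound K hN
  have hM1 : Computable fun a => evidenceBound K (N a) + 1 := Computable.succ.comp hM
  have hB := computable_two_pow (computable_mul hM1 hM1)
  have ha : Computable fun q : (α × ℕ) × ℕ => q.1.1 := Computable.fst.comp .fst
  have hU : Computable fun q : (α × ℕ) × ℕ => q.1.2 := Computable.snd.comp .fst
  have hT : Computable fun q : (α × ℕ) × ℕ => q.2 := Computable.snd
  have key : ComputablePred fun a => ∃ U, U < 2 ^ ((evidenceBound K (N a) + 1) *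
      (evidenceBound K (N a) + 1)) ∧ ∃ T, T < 2 ^ ((evidenceBound K (N a) + 1) *
        (evidenceBound K (N a) + 1)) ∧ CSJustified CS (N a) (evidenceBound K (N a)) U ∧
          Justified L (N a) (evidenceBound K (N a)) (Γ a) U T ∧ PairBit T (t a) (A a) :=
    ComputablePred.exists_nat_lt hB (ComputablePred.exists_nat_lt (hB.comp .fst)
      (ComputablePred.and' (computablePred_csJustified hCS (hN.comp ha) (hM.comp ha) hU)
        (ComputablePred.and'
          (computablePred_justified L (hN.comp ha) (hM.comp ha) (hΓ.comp ha) hU hT)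
          (computablePred_pairBit hT (ht.comp ha) (hA.comp ha)))))
  refine (ComputablePred.and' (ComputablePred.lt' (computable_encode (computable_just ht hA)) hN)
    key).of_eq fun a => ?_
  refine and_congr_right fun h => ?_
  have h1 := Fm.toNat_just_lt (t a) (A a)
  have h2 := le_evidenceBound K (N a)
  have h3 : (Fm.just (t a) (A a)).toNat < N a := h
  rw [leastEvidence_iff_bounded hK (fun t A h => (Fm.toNat_just_lt t A).2.trans h.1)
    (h1.1.trans h3) (h1.2.trans h3),
    leastEvidence_iff_justified h2 (h1.1.trans h3) ((h1.2.trans h3).trans_le h2)]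

/-- Constituents have smaller codes, so all quantifiers can be bounded by `N`. The third clause
repeats the code condition on its right-hand side to match `computablePred_leastEvidence`. -/
theorem isTruthSet_iff (L : JLogic) (CS : CSet) (N Γ : ℕ) : IsTruthSet L CS N Γ ↔
    (∀ A : Fm, encode A < N → encode (Fm.neg A) < N → (HasBit Γ (.neg A) ↔ ¬ HasBit Γ A)) ∧
    (∀ A : Fm, encode A < N → ∀ B : Fm, encode B < N → encode (Fm.imp A B) < N →
      (HasBit Γ (.imp A B) ↔ (HasBit Γ A → HasBit Γ B))) ∧
    (∀ t : Tm, encode t < N → ∀ A : Fm, encode A < N → (AssertedEvidence N Γ t A ↔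
      (Fm.just t A).toNat < N ∧
        LeastEvidence L CS (fun _ => True) (AssertedEvidence N Γ) t A)) ∧
    (L.HasT → ∀ t : Tm, encode t < N → ∀ A : Fm, encode A < N → AssertedEvidence N Γ t A →
      HasBit Γ A) := by
  constructor
  · intro h
    exact ⟨fun A _ => h.neg A, fun A _ B _ => h.imp A B,
      fun t _ A _ => and_congr_right fun hA => h.just t A hA, fun hT t _ A _ => h.refl hT t A⟩
  · rintro ⟨h1, h2, h3, h4⟩
    refine ⟨fun A h => h1 A (A.toNat_neg_lt.trans h) h,
      fun A B h => h2 A ((A.toNat_imp_lt B).1.trans h) B ((A.toNat_imp_lt B).2.trans h) h,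
      fun t A h => ?_, fun hT t A h => ?_⟩
    · have h5 := h3 t ((Fm.toNat_just_lt t A).1.trans h) A ((Fm.toNat_just_lt t A).2.trans h)
      simpa only [AssertedEvidence, and_congr_right_iff, h, true_and, forall_const] using h5
    · exact h4 hT t ((Fm.toNat_just_lt t A).1.trans h.1) A ((Fm.toNat_just_lt t A).2.trans h.1) h

theorem accessible_iff (L : JLogic) (N Γ Δ : ℕ) : Accessible L N Γ Δ ↔
    ∀ t : Tm, encode t < N → ∀ A : Fm, encode A < N → AssertedEvidence N Γ t A →
      HasBit Δ A ∧ (L.Has4 → HasBit Δ (.just t A)) :=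
  ⟨fun h t _ A _ => h t A, fun h t A hA =>
    h t ((Fm.toNat_just_lt t A).1.trans hA.1) A ((Fm.toNat_just_lt t A).2.trans hA.1) hA⟩

theorem computablePred_isTruthSet {K : ℕ} (L : JLogic) {CS : CSet} (hCS : DecidableCS CS)
    (hK : CollapsibleCS K CS) {N Γ : α → ℕ} (hN : Computable N) (hΓ : Computable Γ) :
    ComputablePred fun a => IsTruthSet L CS (N a) (Γ a) := by
  refine ComputablePred.of_eq ?_ fun a => (isTruthSet_iff L CS (N a) (Γ a)).symm
  have ha : Computable fun q : (α × Tm) × Fm => q.1.1 := Computable.fst.comp .fst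
  have ht : Computable fun q : (α × Tm) × Fm => q.1.2 := Computable.snd.comp .fst
  have hA : Computable fun q : (α × Tm) × Fm => q.2 := Computable.snd
  refine ComputablePred.and' ?_ (ComputablePred.and' ?_ (ComputablePred.and' ?_ ?_))
  · refine ComputablePred.forall_lt hN ?_
    have hA : Computable fun q : α × Fm => q.2 := Computable.snd
    have hΓ' : Computable fun q : α × Fm => Γ q.1 := hΓ.comp .fst
    exact ComputablePred.imp'
      (ComputablePred.lt' (computable_encode (computable_neg hA)) (hN.comp .fst))
      (ComputablePred.iff' (computablePred_hasBit hΓ' (computable_neg hA))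
        (computablePred_hasBit hΓ' hA).not)
  · refine ComputablePred.forall_lt hN (ComputablePred.forall_lt (hN.comp .fst) ?_)
    have ha : Computable fun q : (α × Fm) × Fm => q.1.1 := Computable.fst.comp .fst
    have hA : Computable fun q : (α × Fm) × Fm => q.1.2 := Computable.snd.comp .fst
    have hB : Computable fun q : (α × Fm) × Fm => q.2 := Computable.snd
    exact ComputablePred.imp'
      (ComputablePred.lt' (computable_encode (computable_imp hA hB)) (hN.comp ha))
      (ComputablePred.iff' (computablePred_hasBit (hΓ.comp ha) (computable_imp hA hB))
        (ComputablePred.imp' (computablePred_hasBit (hΓ.comp ha) hA)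
          (computablePred_hasBit (hΓ.comp ha) hB)))
  · refine ComputablePred.forall_lt hN (ComputablePred.forall_lt (hN.comp .fst) ?_)
    exact ComputablePred.iff' (computablePred_assertedEvidence (hN.comp ha) (hΓ.comp ha) ht hA)
      (computablePred_leastEvidence hCS hK (hN.comp ha) (hΓ.comp ha) ht hA)
  · refine ComputablePred.imp' (ComputablePred.const' L.HasT)
      (ComputablePred.forall_lt hN (ComputablePred.forall_lt (hN.comp .fst) ?_))
    exact ComputablePred.imp' (computablePred_assertedEvidence (hN.comp ha) (hΓ.comp ha) ht hA)
      (computablePred_hasBit (hΓ.comp ha) hA)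

theorem computablePred_accessible (L : JLogic) {N Γ Δ : α → ℕ} (hN : Computable N)
    (hΓ : Computable Γ) (hΔ : Computable Δ) :
    ComputablePred fun a => Accessible L (N a) (Γ a) (Δ a) := by
  refine ComputablePred.of_eq ?_ fun a => (accessible_iff L (N a) (Γ a) (Δ a)).symm
  refine ComputablePred.forall_lt hN (ComputablePred.forall_lt (hN.comp .fst) ?_)
  have ha : Computable fun q : (α × Tm) × Fm => q.1.1 := Computable.fst.comp .fst
  have ht : Computable fun q : (α × Tm) × Fm => q.1.2 := Computable.snd.comp .fst
  have hA : Computable fun q : (α × Tm) × Fm => q.2 := Computable.snd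
  exact ComputablePred.imp' (computablePred_assertedEvidence (hN.comp ha) (hΓ.comp ha) ht hA)
    (ComputablePred.and' (computablePred_hasBit (hΔ.comp ha) hA)
      (ComputablePred.imp' (ComputablePred.const' L.Has4)
        (computablePred_hasBit (hΔ.comp ha) (computable_just ht hA))))

theorem computablePred_hasCertificate {K : ℕ} (L : JLogic) {CS : CSet} (hCS : DecidableCS CS)
    (hK : CollapsibleCS K CS) {N : α → ℕ} {A : α → Fm} (hN : Computable N) (hA : Computable A) :
    ComputablePred fun a => HasCertificate L CS (N a) (A a) := by
  have hB := computable_two_pow hN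
  refine ComputablePred.exists_nat_lt (computable_two_pow hB) (ComputablePred.and' ?_ ?_)
  · refine ComputablePred.exists_nat_lt (hB.comp .fst) (ComputablePred.and' ?_ ?_)
    · exact ComputablePred.testBit (Computable.snd.comp .fst) .snd
    · exact computablePred_hasBit .snd (hA.comp (Computable.fst.comp .fst))
  · have ha : Computable fun q : (α × ℕ) × ℕ => q.1.1 := Computable.fst.comp .fst
    refine ComputablePred.forall_lt (hB.comp .fst) (ComputablePred.imp' ?_ (ComputablePred.and' ?_
      (ComputablePred.imp' (ComputablePred.const' L.HasD)
        (ComputablePred.exists_nat_lt (hB.comp ha) (ComputablePred.and' ?_ ?_)))))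
    · exact ComputablePred.testBit (Computable.snd.comp .fst) .snd
    · exact computablePred_isTruthSet L hCS hK (hN.comp ha) .snd
    · exact ComputablePred.testBit (Computable.snd.comp (Computable.fst.comp .fst)) .snd
    · exact computablePred_accessible L (hN.comp (ha.comp .fst)) (Computable.snd.comp .fst) .snd

end Computability

/-! ### Decidability of justification logics -/

/-- Mere existence of `K` suffices, because the decision procedure may depend on `CS` in a
nonuniform way. -/
theorem decidableLogic {P : Finset PropScheme} (hP : AxiomatizesCPL P) {L : JLogic} {CS : CSet}
    (hCS : IsConstSpec P L CS) (hdec : DecidableCS CS) (hsch : Schematic P L CS)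
    (hD : L.HasD → AxiomaticallyAppropriate P L CS) : DecidableLogic.{u} P L CS := by
  obtain ⟨K, hK⟩ := hsch.exists_collapsible
  have hsat : ComputablePred fun A : Fm => Satisfiable.{u} L CS A :=
    (computablePred_hasCertificate L hdec hK (Computable.succ.comp (computable_encode .id))
      .id).of_eq fun A => (satisfiable_iff_hasCertificate hP hCS A).symm
  exact ⟨(ComputablePred.comp' hsat (computable_neg .id)).not.of_eq fun A =>
    (derivable_iff_not_satisfiable_neg hP hCS hD A).symm, hsat⟩

end JustLogic

theorem mainTheorem2 (P : Finset JustLogic.PropScheme) (hP : JustLogic.AxiomatizesCPL P) :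
    (∀ L : JustLogic.JLogic,
      (L = .J ∨ L = .JT ∨ L = .J4 ∨ L = .LP) →
      ∀ CS : JustLogic.CSet, JustLogic.IsConstSpec P L CS →
        JustLogic.DecidableCS CS → JustLogic.Schematic P L CS →
        JustLogic.DecidableLogic.{u} P L CS) ∧
    (∀ L : JustLogic.JLogic,
      (L = .JD ∨ L = .JD4) →
      ∀ CS : JustLogic.CSet, JustLogic.IsConstSpec P L CS →
        JustLogic.DecidableCS CS → JustLogic.Schematic P L CS →
        JustLogic.AxiomaticallyAppropriate P L CS →
        JustLogic.DecidableLogic.{u} P L CS) := by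
  refine ⟨fun L hL CS hCS hdec hsch => ?_, fun L _ CS hCS hdec hsch happ => ?_⟩
  · refine JustLogic.decidableLogic hP hCS hdec hsch fun hD => ?_
    rcases hL with rfl | rfl | rfl | rfl <;> simp [JustLogic.JLogic.HasD] at hD
  · exact JustLogic.decidableLogic hP hCS hdec hsch fun _ => happ
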